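/- Let $c\in\mathbb R$, let $\mathbb R^n(c)$ be the simply connected $n$-dimensional space form of curvature $c$ (round sphere, Euclidean space or hyperbolic space), and let $B^n\subset\mathbb R^n(c)$ be a closed geodesic ball of radius $r>0$, with $r<\pi/\sqrt c$ if $c>0$, with outward unit normal $\boldsymbol n$ along $\partial B^n$. Let $(\Sigma,g)$ be a Riemannian surface with non-empty smooth boundary, and let $u:\Sigma\to B^n$ be a branched immersion with $u(\partial\Sigma)\subset\partial B^n$, that is, $u$ is smooth, weakly conformal ($u^*\langle\cdot,\cdot\rangle=\rho g$ with $\rho\ge 0$) and immersed outside a finite set $\mathcal B$. For a hypersurface $K$ and $p\in\partial\Sigma\setminus\mathcal B$, let $\boldsymbol\tau$ be a unit tangent vector of the boundary curve $u|_{\partial\Sigma}$ and $\boldsymbol\nu$ the outward unit conormal of the surface at $p$. The contact angle of $u$ with $K$ at $p$ is the $\theta(p)\in[0,\pi/2]$ with $\cos\theta(p)=\max\{\langle x,\boldsymbol\nu\rangle : x\in T_{u(p)}K,\ |x|=1,\ x\perp\boldsymbol\tau\}$ (the maximum over the empty set being $0$). Assume: (i) the mean curvature vector $\bar H$ of $u$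 in $\mathbb R^n(c)$ is parallel in the normal bundle on $\Sigma\setminus\mathcal B$, $\nabla^\perp\bar H\equiv 0$, and $\bar H\not\equiv 0$; (ii) $u$ has constant contact angle $\theta\in(0,\pi/2]$ with $\partial B^n$ along $\partial\Sigma\setminus\mathcal B$; (iii) $u(\Sigma)$ is contained in a connected embedded totally umbilical hypersurface $M^{n-1}\subset\mathbb R^n(c)$ with smooth unit normal field $\boldsymbol\xi$. Then: (a) the mean curvature vector $H$ of $u$ as a surface in $M$ is parallel in the normal bundle of the surface in $M$, $\nabla^{\perp,M}H\equiv 0$ on $\Sigma\setminus\mathcal B$; (b) $C:=M\cap\partial B^n$ is a smooth totally umbilical hypersurface of $M$, and there are constants $\alpha\in(0,\pi)$ and $\theta_M\in(0,\pi/2]$ such that along all of $\partial\Sigma$ one has $\langle\boldsymbol n,\boldsymbol\xi\rangle=\cos\alpha$, in particular $|\langle\boldsymbol n,\boldsymbol\xi\rangle|<1$ (so $M$ and $\partial B^n$ are transverse there), $u$ has contact angle $\theta_M$ with $C$ inside $M$ at every point of $\partial\Sigma\setminus\mathcal B$, and $$\sin\theta_M=\frac{\sin\theta}{\sqrt{1-\langle\boldsymbol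 n,\boldsymbol\xi\rangle^2}}=\frac{\sin\theta}{\sin\alpha}.$$ -/

import Mathlib

open scoped Manifold ContDiff

namespace SpaceFormPMC

/-! ### The space form of curvature `c`

The model is `{(t, y) ∈ ℝ × ℝⁿ : t² + c |y|² = 1}` (with `t > 0` if `c ≤ 0`), with the metric induced
by `|dy|² + dt² / c`: the round sphere of radius `1/√c` if `c > 0` (with `t/√c` as the last Euclidean
coordinate), one sheet of the hyperboloid in Minkowski space if `c < 0`, and the affine hyperplane
`t = 1`, a copy of Euclidean `ℝⁿ`, if `c = 0`. -/

/-- The linear space `ℝ × ℝⁿ` that contains the model. -/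
abbrev Amb (n : ℕ) : Type := ℝ × EuclideanSpace ℝ (Fin n)

/-- The metric `⟨v, w⟩ = v_y · w_y + v_t w_t / c`. For `c = 0` the last term is zero; tangent vectors of
the model have `v_t = 0` in that case, so nothing is lost. -/
noncomputable def met {n : ℕ} (c : ℝ) (v w : Amb n) : ℝ :=
  inner ℝ v.2 w.2 + c⁻¹ * (v.1 * w.1)

/-- The form `t t' + c y · y'`, which is `c ⟨·, ·⟩` for `c ≠ 0`. The model is a part of its unit
sphere. -/
noncomputable def quad {n : ℕ} (c : ℝ) (x v : Amb n) : ℝ :=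
  x.1 * v.1 + c * inner ℝ x.2 v.2

/-- The space form `ℝⁿ(c)`: sphere, Euclidean space or hyperbolic space of curvature `c`. -/
def spaceForm (n : ℕ) (c : ℝ) : Set (Amb n) :=
  {x | quad c x x = 1 ∧ (c ≤ 0 → 0 < x.1)}

/-- The projection of `ℝ × ℝⁿ` onto the tangent space `{v | quad c x v = 0}` of the space form at `x`,
along the position vector `x`, which is orthogonal to that tangent space if `c ≠ 0` (for `c = 0` the
derivative of a tangent field is tangent already). Hence `projN c x (D_X Y)` is the Levi-Civita
connection of the space form. -/
noncomputable def projN {n : ℕ} (c : ℝ) (x z : Amb n) : Amb n :=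
  z - quad c x z • x

/-! ### Geodesic balls -/

/-- The solution of `s'' + c s = 0`, `s 0 = 0`, `s' 0 = 1`. -/
noncomputable def sn (c t : ℝ) : ℝ :=
  if 0 < c then Real.sin (√c * t) / √c
  else if c < 0 then Real.sinh (√(-c) * t) / √(-c)
  else t

/-- The solution of `s'' + c s = 0`, `s 0 = 1`, `s' 0 = 0`. -/
noncomputable def cs (c t : ℝ) : ℝ :=
  if 0 < c then Real.cos (√c * t)
  else if c < 0 then Real.cosh (√(-c) * t)
  else 1

/-- The geodesic of the space form with initial point `o` and unit initial velocity `v`. -/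
noncomputable def geod {n : ℕ} (c : ℝ) (o v : Amb n) (t : ℝ) : Amb n :=
  cs c t • o + sn c t • v

/-- Unit tangent vectors of the space form at `o`. -/
def unitTangent {n : ℕ} (c : ℝ) (o : Amb n) : Set (Amb n) :=
  {v | quad c o v = 0 ∧ met c v v = 1}

/-- The closed geodesic ball with centre `o` and radius `r`. -/
def geodBall {n : ℕ} (c : ℝ) (o : Amb n) (r : ℝ) : Set (Amb n) :=
  {x | ∃ v ∈ unitTangent c o, ∃ t ∈ Set.Icc 0 r, x = geod c o v t}

/-- The boundary of the geodesic ball, a geodesic sphere. -/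
def geodSphere {n : ℕ} (c : ℝ) (o : Amb n) (r : ℝ) : Set (Amb n) :=
  {x | ∃ v ∈ unitTangent c o, x = geod c o v r}

/-- The outward unit normal of the geodesic ball at a boundary point `x`, that is, the velocity at time
`r` of the unit speed geodesic from `o` that reaches `x` at time `r`. -/
noncomputable def outNormal {n : ℕ} (c : ℝ) (o : Amb n) (r : ℝ) (x : Amb n) : Amb n :=
  (sn c r)⁻¹ • (cs c r • x - o)

/-! ### Submanifolds and totally umbilical hypersurfaces -/

/-- `X` is a smooth embedded submanifold of codimension `k` of the linear space `ℝ × ℝⁿ`. -/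
def IsSubmanifold {n : ℕ} (k : ℕ) (X : Set (Amb n)) : Prop :=
  ∀ p ∈ X, ∃ U : Set (Amb n), IsOpen U ∧ p ∈ U ∧ ∃ F : Amb n → (Fin k → ℝ),
    ContDiffOn ℝ ∞ F U ∧ Function.Surjective (fderiv ℝ F p) ∧ X ∩ U = {x ∈ U | F x = 0}

/-- The tangent space of the submanifold `X` at `p`: the vectors that annihilate every smooth function
that vanishes on `X` near `p`. -/
def tangentTo {n : ℕ} (X : Set (Amb n)) (p : Amb n) : Submodule ℝ (Amb n) where
  carrier := {v | ∀ f : Amb n → ℝ, ContDiffAt ℝ ∞ f p → (∀ᶠ x in nhdsWithin p X, f x = 0) →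
    fderiv ℝ f p v = 0}
  zero_mem' := fun f _ _ => map_zero _
  add_mem' := fun {v w} hv hw f hf h0 => by rw [map_add, hv f hf h0, hw f hf h0, add_zero]
  smul_mem' := fun a v hv f hf h0 => by rw [map_smul, hv f hf h0, smul_zero]

/-- `X` is a totally umbilical hypersurface, with unit normal field `η`, of the submanifold `W` of the
space form. Here `P x` is the orthogonal projection onto the tangent space of `W` at `x ∈ W`, so that
`P x (D_v Y)` is the Levi-Civita connection of `W`, and `k` is the codimension of `X` in `ℝ × ℝⁿ`. The
field `η` only matters on `X`; off `X` it is any local smooth extension. -/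
structure IsUmbilicalHypersurface {n : ℕ} (c : ℝ) (W : Set (Amb n)) (P : Amb n → Amb n → Amb n)
    (k : ℕ) (X : Set (Amb n)) (η : Amb n → Amb n) : Prop where
  subset : X ⊆ W
  submanifold : IsSubmanifold k X
  smooth : ∀ p ∈ X, ContDiffAt ℝ ∞ η p
  tangent : ∀ p ∈ X, η p ∈ tangentTo W p
  unit : ∀ p ∈ X, met c (η p) (η p) = 1
  normal : ∀ p ∈ X, ∀ v ∈ tangentTo X p, met c (η p) v = 0
  umbilic : ∀ p ∈ X, ∃ l : ℝ, ∀ v ∈ tangentTo X p, P p (fderiv ℝ η p v) = -(l • v)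

/-- The orthogonal projection onto the tangent space, at `x`, of a hypersurface of the space form with
unit normal field `ξ`. -/
noncomputable def projM {n : ℕ} (c : ℝ) (ξ : Amb n → Amb n) (x z : Amb n) : Amb n :=
  projN c x z - met c (projN c x z) (ξ x) • ξ x

/-! ### Branched immersed surfaces

Surfaces with boundary are modelled on the half plane `{y | 0 ≤ y 0}`. The tangent space at `p` is `ℝ²`
in the coordinates of the preferred chart at `p`; at a boundary point, `w 0 = 0` says that `w` is
tangent to the boundary and `w 0 < 0` that it points outward. -/

section Surface

variable {n : ℕ} {S : Type*} [TopologicalSpace S] [ChartedSpace (EuclideanHalfSpace 2) S]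

/-- The differential of `u` at `p`. -/
noncomputable def du (u : S → Amb n) (p : S) : EuclideanSpace ℝ (Fin 2) →L[ℝ] Amb n :=
  mfderiv (𝓡∂ 2) 𝓘(ℝ, Amb n) u p

/-- The points at which `u` is not immersed. -/
def branchSet (u : S → Amb n) : Set S :=
  {p | ¬ Function.Injective (du u p)}

/-- `u` is a branched immersion: smooth, weakly conformal for the metric `g`, and immersed except at
finitely many points. -/
structure IsBranchedImmersion [IsManifold (𝓡∂ 2) ∞ S] (c : ℝ)
    (g : Bundle.ContMDiffRiemannianMetric (𝓡∂ 2) ∞ (EuclideanSpace ℝ (Fin 2))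
      (fun p : S => TangentSpace (𝓡∂ 2) p))
    (u : S → Amb n) : Prop where
  smooth : ContMDiff (𝓡∂ 2) 𝓘(ℝ, Amb n) ∞ u
  mem : ∀ p, u p ∈ spaceForm n c
  conformal : ∃ ρ : S → ℝ, ∀ p, 0 ≤ ρ p ∧
    ∀ v w : TangentSpace (𝓡∂ 2) p, met c (du u p v) (du u p w) = ρ p * g.inner p v w
  finite : (branchSet u).Finite

/-- The component of `z` orthogonal to the plane spanned by `a` and `b`. -/
noncomputable def perp (c : ℝ) (a b z : Amb n) : Amb n :=
  z - (met c a a * met c b b - met c a b ^ 2)⁻¹ •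
    ((met c b b * met c z a - met c a b * met c z b) • a +
      (met c a a * met c z b - met c a b * met c z a) • b)

/-- The partial derivative `∂ᵢ f` of a map on the closed half plane (one-sided at the boundary). -/
noncomputable def pd {F : Type*} [NormedAddCommGroup F] [NormedSpace ℝ F]
    (i : Fin 2) (f : EuclideanSpace ℝ (Fin 2) → F) (y : EuclideanSpace ℝ (Fin 2)) : F :=
  fderivWithin ℝ f (Set.range (𝓡∂ 2)) y (EuclideanSpace.single i 1)

/-- The component of `z` normal to the parametrized surface `f` at `y`, inside the tangent space of a
submanifold of the space form that contains the surface and has tangential projection `P`. -/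
noncomputable def normalPart (c : ℝ) (P : Amb n → Amb n → Amb n)
    (f : EuclideanSpace ℝ (Fin 2) → Amb n) (y : EuclideanSpace ℝ (Fin 2)) (z : Amb n) : Amb n :=
  perp c (pd 0 f y) (pd 1 f y) (P (f y) z)

/-- The second fundamental form `A(∂ᵢ f, ∂ⱼ f)` of the parametrized surface `f` in that submanifold,
the normal part of the covariant derivative of `∂ⱼ f` along `∂ᵢ f`. -/
noncomputable def secondFF (c : ℝ) (P : Amb n → Amb n → Amb n)
    (f : EuclideanSpace ℝ (Fin 2) → Amb n) (i j : Fin 2) (y : EuclideanSpace ℝ (Fin 2)) : Amb n :=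
  normalPart c P f y (pd i (pd j f) y)

/-- The mean curvature vector, half the trace of the second fundamental form with respect to the first
fundamental form. -/
noncomputable def meanCurv (c : ℝ) (P : Amb n → Amb n → Amb n)
    (f : EuclideanSpace ℝ (Fin 2) → Amb n) (y : EuclideanSpace ℝ (Fin 2)) : Amb n :=
  (2 * (met c (pd 0 f y) (pd 0 f y) * met c (pd 1 f y) (pd 1 f y)
      - met c (pd 0 f y) (pd 1 f y) ^ 2))⁻¹ •
    (met c (pd 1 f y) (pd 1 f y) • secondFF c P f 0 0 y
      - (2 * met c (pd 0 f y) (pd 1 f y)) • secondFF c P f 0 1 y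
      + met c (pd 0 f y) (pd 0 f y) • secondFF c P f 1 1 y)

/-- The map `u` in the coordinates of the preferred chart at `p`. -/
noncomputable def localRep (u : S → Amb n) (p : S) : EuclideanSpace ℝ (Fin 2) → Amb n :=
  u ∘ (extChartAt (𝓡∂ 2) p).symm

/-- The mean curvature vector of `u` at `p`, in the submanifold with tangential projection `P`. -/
noncomputable def meanCurvAt (c : ℝ) (P : Amb n → Amb n → Amb n) (u : S → Amb n) (p : S) : Amb n :=
  meanCurv c P (localRep u p) (extChartAt (𝓡∂ 2) p p)

/-- The mean curvature vector `H` of `u`, in the submanifold with tangential projection `P`, is parallel: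
away from the branch points the normal part of the covariant derivative of `H` in each direction
vanishes. -/
def HasParallelMeanCurv (c : ℝ) (P : Amb n → Amb n → Amb n) (u : S → Amb n) : Prop :=
  ∀ p ∉ branchSet u, ∀ i : Fin 2,
    normalPart c P (localRep u p) (extChartAt (𝓡∂ 2) p p)
      (pd i (meanCurv c P (localRep u p)) (extChartAt (𝓡∂ 2) p p)) = 0

/-- `ν` is the outward unit conormal of the surface at the boundary point `p`. -/
def IsOutConormal (c : ℝ) (u : S → Amb n) (p : S) (ν : Amb n) : Prop :=
  met c ν ν = 1 ∧ (∃ w : EuclideanSpace ℝ (Fin 2), w 0 < 0 ∧ ν = du u p w) ∧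
    ∀ t : EuclideanSpace ℝ (Fin 2), t 0 = 0 → met c (du u p t) ν = 0

/-- `θ ∈ [0, π/2]` is the contact angle of the surface with `K` at the boundary point `p`: `cos θ` is
the maximum of `⟨x, ν⟩` over the unit vectors `x` tangent to `K` and orthogonal to the boundary curve.
That maximum is non-negative, since `-x` competes with `x`, so adding `0` has no effect unless there is
no such `x`; this happens only if `K` is a curve, and then `ν` is normal to `K` and the angle is
`π/2`. -/
def IsContactAngle (c : ℝ) (K : Set (Amb n)) (u : S → Amb n) (p : S) (θ : ℝ) : Prop :=
  θ ∈ Set.Icc 0 (Real.pi / 2) ∧ ∃ ν, IsOutConormal c u p ν ∧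
    IsGreatest (insert 0 {s | ∃ x ∈ tangentTo K (u p), met c x x = 1 ∧
      (∀ t : EuclideanSpace ℝ (Fin 2), t 0 = 0 → met c x (du u p t) = 0) ∧ s = met c x ν})
      (Real.cos θ)

end Surface

end SpaceFormPMC

open SpaceFormPMC

/-!
Let `ξ` be the unit normal field of the umbilical hypersurface `M`. Unless `M` is a curve, its
principal curvature is locally constant, so `D_v ξ = -l v` for a single constant `l`.

For a surface in `M` this gives `H̄ = H + l ξ`. The derivative `D_v (l ξ) = -l² v` is tangent to the
surface, so the normal derivatives of `H̄` and `H` in `M` agree.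

By the same equation, `⟨x - o, ξ⟩ + (l / 2) |x - o|²` is constant along `M`, and `|x - o|²` is
constant on a geodesic sphere about `o`; so `⟨n, ξ⟩ = κ` is constant on `M ∩ ∂B`. The unit normal of
`M ∩ ∂B` in `M` is `(n - κ ξ) / √(1 - κ²)`, whose derivative is again a multiple of the identity.

Finally, the sine of a contact angle is `|⟨m, ν⟩|`, where `m` is the unit normal of the
hypersurface and `ν` the conormal of the surface. Since `ν ⟂ ξ`, passing from `n` to
`(n - κ ξ) / √(1 - κ²)` divides it by `√(1 - κ²)`.
-/

namespace SpaceFormPMC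

section Metric

variable {n : ℕ} (c : ℝ)

/-- The metric `met c` as a continuous bilinear map, which gives access to its calculus. -/
noncomputable def metL : Amb n →L[ℝ] Amb n →L[ℝ] ℝ :=
  (innerSL ℝ).bilinearComp (ContinuousLinearMap.snd ℝ _ _) (ContinuousLinearMap.snd ℝ _ _) +
    c⁻¹ • (ContinuousLinearMap.mul ℝ ℝ).bilinearComp (ContinuousLinearMap.fst ℝ _ _)
      (ContinuousLinearMap.fst ℝ _ _)

/-- The form `quad c` as a continuous bilinear map, which gives access to its calculus. -/
noncomputable def quadL : Amb n →L[ℝ] Amb n →L[ℝ] ℝ :=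
  (ContinuousLinearMap.mul ℝ ℝ).bilinearComp (ContinuousLinearMap.fst ℝ _ _)
      (ContinuousLinearMap.fst ℝ _ _) +
    c • (innerSL ℝ).bilinearComp (ContinuousLinearMap.snd ℝ _ _) (ContinuousLinearMap.snd ℝ _ _)

variable {c}

theorem metL_apply (v w : Amb n) : metL c v w = met c v w := by
  simp [metL, met]

theorem quadL_apply (v w : Amb n) : quadL c v w = quad c v w := by
  simp [quadL, quad]

theorem met_comm (v w : Amb n) : met c v w = met c w v := by
  simp [met, real_inner_comm, mul_comm]

theorem quad_comm (v w : Amb n) : quad c v w = quad c w v := by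
  simp [quad, real_inner_comm, mul_comm]

theorem met_add_left (u v w : Amb n) : met c (u + v) w = met c u w + met c v w := by
  simp [← metL_apply]

theorem met_add_right (u v w : Amb n) : met c u (v + w) = met c u v + met c u w := by
  simp [← metL_apply]

theorem met_sub_left (u v w : Amb n) : met c (u - v) w = met c u w - met c v w := by
  simp [← metL_apply]

theorem met_sub_right (u v w : Amb n) : met c u (v - w) = met c u v - met c u w := by
  simp [← metL_apply]

theorem met_smul_left (a : ℝ) (v w : Amb n) : met c (a • v) w = a * met c v w := by
  simp [← metL_apply]

theorem met_smul_right (a : ℝ) (v w : Amb n) : met c v (a • w) = a * met c v w := by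
  simp [← metL_apply]

theorem met_neg_right (v w : Amb n) : met c v (-w) = -met c v w := by
  simp [← metL_apply]

theorem met_zero_left (w : Amb n) : met c 0 w = 0 := by
  simp [← metL_apply]

theorem quad_add_left (u v w : Amb n) : quad c (u + v) w = quad c u w + quad c v w := by
  simp [← quadL_apply]

theorem quad_add_right (u v w : Amb n) : quad c u (v + w) = quad c u v + quad c u w := by
  simp [← quadL_apply]

theorem quad_sub_right (u v w : Amb n) : quad c u (v - w) = quad c u v - quad c u w := by
  simp [← quadL_apply]

theorem quad_smul_left (a : ℝ) (v w : Amb n) : quad c (a • v) w = a * quad c v w := by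
  simp [← quadL_apply]

theorem quad_smul_right (a : ℝ) (v w : Amb n) : quad c v (a • w) = a * quad c v w := by
  simp [← quadL_apply]

theorem quad_eq_mul_met (hc : c ≠ 0) (v w : Amb n) : quad c v w = c * met c v w := by
  simp only [quad, met]
  field_simp
  ring

theorem eq_zero_or_met_eq_zero {x v : Amb n} (hv : quad c x v = 0) : c = 0 ∨ met c x v = 0 :=
  or_iff_not_imp_left.2 fun hc =>
    (mul_eq_zero.1 ((quad_eq_mul_met hc x v).symm.trans hv)).resolve_left hc

theorem fst_eq_one {x : Amb n} (hx : x ∈ spaceForm n 0) : x.1 = 1 := by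
  have h0 : 0 < x.1 := hx.2 le_rfl
  have h1 : x.1 * x.1 = 1 := by simpa [quad] using hx.1
  nlinarith

theorem quad_eq_mul_met_of_tangent {x v : Amb n} (hx : x ∈ spaceForm n c) (hv : quad c x v = 0)
    (w : Amb n) : quad c v w = c * met c v w := by
  rcases eq_or_ne c 0 with rfl | hc
  · have hv1 : v.1 = 0 := by simpa [quad, fst_eq_one hx] using hv
    simp [quad, hv1]
  · exact quad_eq_mul_met hc v w

theorem snd_ne_zero_of_tangent {x v : Amb n} (hx : x ∈ spaceForm n c) (hc : c ≤ 0)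
    (hv : quad c x v = 0) (hv0 : v ≠ 0) : v.2 ≠ 0 := by
  intro h2
  have hv1 : v.1 = 0 := by simpa [quad, h2, (hx.2 hc).ne'] using hv
  exact hv0 (Prod.ext hv1 h2)

theorem sq_fst_mul_met_self {x v : Amb n} (hx : quad c x x = 1) (hv : quad c x v = 0) :
    x.1 ^ 2 * met c v v =
      ‖v.2‖ ^ 2 - c * (‖x.2‖ ^ 2 * ‖v.2‖ ^ 2 - inner ℝ x.2 v.2 ^ 2) := by
  simp only [quad, met, real_inner_self_eq_norm_sq] at hx hv ⊢
  have hc : c⁻¹ * c ^ 2 = c := by rcases eq_or_ne c 0 with rfl | hc <;> [simp; field_simp]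
  have hxv : x.1 * v.1 = -(c * inner ℝ x.2 v.2) := by linarith
  calc x.1 ^ 2 * (‖v.2‖ ^ 2 + c⁻¹ * (v.1 * v.1))
      = x.1 * x.1 * ‖v.2‖ ^ 2 + c⁻¹ * (x.1 * v.1) ^ 2 := by ring
    _ = (1 - c * ‖x.2‖ ^ 2) * ‖v.2‖ ^ 2 + c⁻¹ * c ^ 2 * inner ℝ x.2 v.2 ^ 2 := by
        rw [hxv, ← hx]; ring
    _ = _ := by rw [hc]; ring

theorem met_self_pos {x v : Amb n} (hx : x ∈ spaceForm n c) (hv : quad c x v = 0)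
    (hv0 : v ≠ 0) : 0 < met c v v := by
  rcases le_or_gt c 0 with hc | hc
  · have hv2 : 0 < ‖v.2‖ ^ 2 := by
      have := snd_ne_zero_of_tangent hx hc hv hv0
      positivity
    have hcs : inner ℝ x.2 v.2 ^ 2 ≤ ‖x.2‖ ^ 2 * ‖v.2‖ ^ 2 := by
      rw [← mul_pow, ← sq_abs]
      gcongr
      exact abs_real_inner_le_norm x.2 v.2
    have h : 0 < x.1 ^ 2 * met c v v := by
      rw [sq_fst_mul_met_self hx.1 hv]
      nlinarith [mul_nonneg (neg_nonneg.2 hc) (sub_nonneg.2 hcs)]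
    exact pos_of_mul_pos_right h (sq_nonneg _)
  · have := inv_pos.2 hc
    simp only [met, real_inner_self_eq_norm_sq, ← sq]
    rcases not_and_or.1 (mt (fun h => Prod.ext h.1 h.2) hv0 : ¬(v.1 = 0 ∧ v.2 = 0)) with h | h
    · have : v.1 ≠ 0 := h
      positivity
    · have : v.2 ≠ 0 := h
      positivity

theorem met_self_nonneg {x v : Amb n} (hx : x ∈ spaceForm n c) (hv : quad c x v = 0) :
    0 ≤ met c v v := by
  rcases eq_or_ne v 0 with rfl | hv0
  · exact (met_zero_left 0).ge
  · exact (met_self_pos hx hv hv0).le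

theorem met_sub_smul_self {a : Amb n} (ha : met c a a = 1) (b : Amb n) :
    met c (b - met c a b • a) (b - met c a b • a) = met c b b - met c a b ^ 2 := by
  simp only [met_sub_left, met_sub_right, met_smul_left, met_smul_right, ha, met_comm b a]
  ring

theorem quad_sub_smul_eq_zero {x a b : Amb n} (ha : quad c x a = 0) (hb : quad c x b = 0)
    (s : ℝ) : quad c x (b - s • a) = 0 := by
  rw [quad_sub_right, quad_smul_right, ha, hb, mul_zero, sub_zero]

theorem met_sq_le {x a b : Amb n} (hx : x ∈ spaceForm n c) (ha : quad c x a = 0)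
    (hb : quad c x b = 0) (ha1 : met c a a = 1) : met c a b ^ 2 ≤ met c b b := by
  have h := met_self_nonneg hx (quad_sub_smul_eq_zero ha hb (met c a b))
  rw [met_sub_smul_self ha1] at h
  exact sub_nonneg.1 h

/-- The Gram determinant of two vectors for the metric `met c`. -/
noncomputable def gramDet (c : ℝ) (a b : Amb n) : ℝ :=
  met c a a * met c b b - met c a b ^ 2

theorem gramDet_pos {x a b : Amb n} (hx : x ∈ spaceForm n c) (ha : quad c x a = 0)
    (hb : quad c x b = 0) (hab : LinearIndependent ℝ ![a, b]) : 0 < gramDet c a b := by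
  have hpa : 0 < met c a a := met_self_pos hx ha (hab.ne_zero 0)
  have hw : met c a a • b - met c a b • a ≠ 0 := fun h =>
    hpa.ne' (LinearIndependent.pair_iff.1 hab (-met c a b) (met c a a)
      (by rw [neg_smul, neg_add_eq_sub, h])).2
  have hpos := met_self_pos hx (quad_sub_smul_eq_zero ha
    (by rw [quad_smul_right, hb, mul_zero] : quad c x (met c a a • b) = 0) (met c a b)) hw
  have heq : met c (met c a a • b - met c a b • a) (met c a a • b - met c a b • a) =
      met c a a * gramDet c a b := by
    simp only [gramDet, met_sub_left, met_sub_right, met_smul_left, met_smul_right, met_comm b a]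
    ring
  rw [heq] at hpos
  exact pos_of_mul_pos_right hpos hpa.le

end Metric

section GeneralizedTrig

variable {c r : ℝ}

theorem cs_zero_left (r : ℝ) : cs 0 r = 1 := by simp [cs]

theorem cs_sq_add_mul_sn_sq (c r : ℝ) : cs c r ^ 2 + c * sn c r ^ 2 = 1 := by
  unfold cs sn
  split_ifs with h1 h2
  · rw [div_pow, Real.sq_sqrt h1.le, mul_div_cancel₀ _ h1.ne', Real.cos_sq_add_sin_sq]
  · rw [div_pow, Real.sq_sqrt (neg_pos.2 h2).le, div_neg, mul_neg, mul_div_cancel₀ _ h2.ne,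
      ← sub_eq_add_neg, Real.cosh_sq_sub_sinh_sq]
  · obtain rfl : c = 0 := by linarith
    simp

theorem sn_pos (hr : 0 < r) (hrc : 0 < c → r < Real.pi / √c) : 0 < sn c r := by
  unfold sn
  split_ifs with h1 h2
  · have hs : 0 < √c := Real.sqrt_pos.2 h1
    refine div_pos (Real.sin_pos_of_pos_of_lt_pi (by positivity) ?_) hs
    rw [mul_comm]
    exact (lt_div_iff₀ hs).1 (hrc h1)
  · have hs : 0 < √(-c) := Real.sqrt_pos.2 (neg_pos.2 h2)
    exact div_pos (Real.sinh_pos_iff.2 (by positivity)) hs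
  · exact hr

theorem one_le_cs (hc : c ≤ 0) (r : ℝ) : 1 ≤ cs c r := by
  unfold cs
  split_ifs with h1 h2
  · exact absurd h1 hc.not_gt
  · exact Real.one_le_cosh _
  · exact le_rfl

end GeneralizedTrig

section Submanifold

open Filter Topology

variable {n k : ℕ} {X Y U : Set (Amb n)} {p : Amb n}

theorem tangentTo_mono_of_nhdsWithin_le (h : 𝓝[X] p ≤ 𝓝[Y] p) : tangentTo X p ≤ tangentTo Y p :=
  fun _ hv f hf h0 => hv f hf (h h0)

theorem tangentTo_mono (h : X ⊆ Y) : tangentTo X p ≤ tangentTo Y p :=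
  tangentTo_mono_of_nhdsWithin_le (nhdsWithin_mono p h)

theorem mem_tangentTo_of_hasFDerivWithinAt {E : Type*} [NormedAddCommGroup E] [NormedSpace ℝ E]
    {f : E → Amb n} {f' : E →L[ℝ] Amb n} {s : Set E} {y : E} (hf : HasFDerivWithinAt f f' s y)
    (hs : UniqueDiffWithinAt ℝ s y) (hy : y ∈ s) (hX : ∀ᶠ z in 𝓝[s] y, f z ∈ X) (w : E) :
    f' w ∈ tangentTo X (f y) := by
  intro h hh h0
  have hlim : Tendsto f (𝓝[s] y) (𝓝[X] (f y)) :=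
    tendsto_nhdsWithin_iff.2 ⟨hf.continuousWithinAt, hX⟩
  have hcomp := (hh.differentiableAt (by simp)).hasFDerivAt.comp_hasFDerivWithinAt y hf
  have hzero : HasFDerivWithinAt (h ∘ f) (0 : E →L[ℝ] ℝ) s y :=
    (hasFDerivWithinAt_const (0 : ℝ) _ _).congr_of_eventuallyEq (hlim.eventually h0)
      (h0.self_of_nhdsWithin (hX.self_of_nhdsWithin hy))
  exact DFunLike.congr_fun (hs.eq hcomp hzero) w

theorem mem_tangentTo_of_hasFDerivAt {E : Type*} [NormedAddCommGroup E] [NormedSpace ℝ E]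
    {f : E → Amb n} {f' : E →L[ℝ] Amb n} {y : E} (hf : HasFDerivAt f f' y)
    (hX : ∀ᶠ z in 𝓝 y, f z ∈ X) (w : E) : f' w ∈ tangentTo X (f y) :=
  mem_tangentTo_of_hasFDerivWithinAt hf.hasFDerivWithinAt uniqueDiffWithinAt_univ (Set.mem_univ _)
    (by rwa [nhdsWithin_univ]) w

/-- `F` is a local defining map at `p` of the submanifold `X` of codimension `k`: it is a submersion
at `p`, and `X` is its zero set in the neighbourhood `U` of `p`. -/
structure IsDefiningMap (X U : Set (Amb n)) (p : Amb n) (F : Amb n → Fin k → ℝ) : Prop where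
  isOpen : IsOpen U
  mem : p ∈ U
  contDiffOn : ContDiffOn ℝ ∞ F U
  surjective : Function.Surjective (fderiv ℝ F p)
  inter_eq : X ∩ U = {x ∈ U | F x = 0}

theorem isSubmanifold_iff :
    IsSubmanifold k X ↔ ∀ p ∈ X, ∃ U, ∃ F : Amb n → Fin k → ℝ, IsDefiningMap X U p F := by
  refine forall₂_congr fun p _ => ⟨?_, ?_⟩
  · rintro ⟨U, hU, hpU, F, hF, hsurj, hX⟩
    exact ⟨U, F, hU, hpU, hF, hsurj, hX⟩
  · rintro ⟨U, F, hU, hpU, hF, hsurj, hX⟩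
    exact ⟨U, hU, hpU, F, hF, hsurj, hX⟩

namespace IsDefiningMap

variable {F : Amb n → Fin k → ℝ}

theorem mem_nhds (hF : IsDefiningMap X U p F) : U ∈ 𝓝 p :=
  hF.isOpen.mem_nhds hF.mem

theorem contDiffAt (hF : IsDefiningMap X U p F) : ContDiffAt ℝ ∞ F p :=
  hF.contDiffOn.contDiffAt hF.mem_nhds

theorem nhdsWithin_eq (hF : IsDefiningMap X U p F) : 𝓝[X] p = 𝓝[{x | F x = 0}] p := by
  rw [← nhdsWithin_inter_of_mem' (s := X) (mem_nhdsWithin_of_mem_nhds hF.mem_nhds), hF.inter_eq,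
    ← nhdsWithin_inter_of_mem' (s := {x | F x = 0}) (mem_nhdsWithin_of_mem_nhds hF.mem_nhds)]
  congr 1
  exact Set.inter_comm U {x | F x = 0}

theorem apply_eq_zero (hF : IsDefiningMap X U p F) (hp : p ∈ X) : F p = 0 :=
  (hF.inter_eq.subset ⟨hp, hF.mem⟩).2

theorem eventually_eq_zero (hF : IsDefiningMap X U p F) : ∀ᶠ x in 𝓝[X] p, F x = 0 := by
  rw [hF.nhdsWithin_eq]
  exact self_mem_nhdsWithin

theorem fderiv_eq_zero (hF : IsDefiningMap X U p F) {v : Amb n} (hv : v ∈ tangentTo X p) :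
    fderiv ℝ F p v = 0 := by
  ext i
  have hi := hasFDerivAt_pi'.1 (hF.contDiffAt.differentiableAt (by simp)).hasFDerivAt i
  have hFi := hv (fun x => F x i) (contDiffAt_pi.1 hF.contDiffAt i)
    (hF.eventually_eq_zero.mono fun x hx => congrFun hx i)
  rwa [hi.fderiv] at hFi

theorem exists_parametrization_ker (hF : IsDefiningMap X U p F) (hp : p ∈ X) :
    ∃ (φ : (fderiv ℝ F p).ker → Amb n) (π : Amb n →L[ℝ] (fderiv ℝ F p).ker),
      ContDiffAt ℝ ∞ φ 0 ∧ φ 0 = p ∧ HasFDerivAt φ (fderiv ℝ F p).ker.subtypeL 0 ∧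
      map φ (𝓝 0) = 𝓝[X] p ∧ ∀ᶠ y in 𝓝 0, π (φ y - p) = y := by
  have hstrict := hF.contDiffAt.hasStrictFDerivAt (by simp)
  have hrange : (fderiv ℝ F p).range = ⊤ := LinearMap.range_eq_top.2 hF.surjective
  have hker : (fderiv ℝ F p).ker.ClosedComplemented :=
    Submodule.ClosedComplemented.of_finiteDimensional _
  set D := hstrict.implicitFunctionDataOfComplemented F _ hrange hker with hD
  have hright : D.rightFun p = 0 := by simp [hD]
  have hpt : D.pt = p := rfl
  have hleft : D.leftFun = F := rfl
  have hpair : D.prodFun D.pt = (0, 0) := by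
    rw [ImplicitFunctionData.prodFun_apply, hpt, hright, hleft, hF.apply_eq_zero hp]
  refine ⟨D.implicitFunction 0, Classical.choose hker, ?_, ?_, ?_, ?_, ?_⟩
  · have h := D.contDiffAt_implicitFunction (n := ∞) hF.contDiffAt
      (by simp only [hD, HasStrictFDerivAt.implicitFunctionDataOfComplemented]; fun_prop) (by simp)
    rw [hpair] at h
    exact h.comp (0 : (fderiv ℝ F p).ker) (f := fun y => ((0 : Fin k → ℝ), y)) (by fun_prop)
  · have h := D.implicitFunction_apply_image.self_of_nhds
    rwa [hpt, hright, hleft, hF.apply_eq_zero hp] at h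
  · have h := D.hasStrictFDerivAt_implicitFunction (fderiv ℝ F p).ker.subtypeL
      (by ext1 y; exact Classical.choose_spec hker y) (by ext1 y; exact y.2)
    rw [hpt, hright, hleft, hF.apply_eq_zero hp] at h
    exact h.hasFDerivAt
  · have h := D.map_implicitFunction_nhdsWithin_preimage Set.univ
    rw [hpt, hright, hleft, hF.apply_eq_zero hp, Set.preimage_univ, nhdsWithin_univ,
      Set.univ_inter] at h
    exact h.trans hF.nhdsWithin_eq.symm
  · have h := D.rightFun_implicitFunction
    rw [hpair, nhds_prod_eq] at h
    exact h.curry.self_of_nhds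

theorem tangentTo_eq_ker (hF : IsDefiningMap X U p F) (hp : p ∈ X) :
    tangentTo X p = (fderiv ℝ F p).ker := by
  refine le_antisymm (fun v hv => hF.fderiv_eq_zero hv) fun v hv => ?_
  obtain ⟨φ, π, -, hφ0, hφ', hmap, -⟩ := hF.exists_parametrization_ker hp
  have h := mem_tangentTo_of_hasFDerivAt hφ' (hmap.le self_mem_nhdsWithin) ⟨v, hv⟩
  rwa [hφ0] at h

theorem inter_levelSet (hF : IsDefiningMap X U p F) {g : Amb n → ℝ}
    (hg : ContDiff ℝ ∞ g) {w : Amb n} (hw : w ∈ tangentTo X p) (hgw : fderiv ℝ g p w ≠ 0) :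
    IsDefiningMap (k := k + 1) (X ∩ {x | g x = 0}) U p fun x => Fin.cons (g x) (F x) where
  isOpen := hF.isOpen
  mem := hF.mem
  contDiffOn := contDiffOn_pi.2 (Fin.cases hg.contDiffOn (contDiffOn_pi.1 hF.contDiffOn))
  surjective z := by
    have hgd := (hg.differentiable (by simp) p).hasFDerivAt
    have hFd := (hF.contDiffAt.differentiableAt (by simp)).hasFDerivAt
    rw [(hgd.finCons hFd).fderiv]
    obtain ⟨v, hv⟩ := hF.surjective (Fin.tail z)
    refine ⟨v + ((z 0 - fderiv ℝ g p v) / fderiv ℝ g p w) • w, funext (Fin.cases ?_ fun j => ?_)⟩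
    · change fderiv ℝ g p _ = z 0
      rw [map_add, map_smul, smul_eq_mul, div_mul_cancel₀ _ hgw, add_sub_cancel]
    · change fderiv ℝ F p _ j = Fin.tail z j
      rw [map_add, map_smul, hF.fderiv_eq_zero hw, smul_zero, add_zero, hv]
  inter_eq := by
    ext x
    have hX := Set.ext_iff.1 hF.inter_eq x
    have hcons : (Fin.cons (g x) (F x) : Fin (k + 1) → ℝ) = 0 ↔ g x = 0 ∧ F x = 0 := by
      simp only [funext_iff, Fin.forall_fin_succ, Fin.cons_zero, Fin.cons_succ, Pi.zero_apply]
    simp only [Set.mem_inter_iff, Set.mem_ofPred_eq, hcons] at hX ⊢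
    tauto

end IsDefiningMap

theorem isSubmanifold_zero_of_isOpen (hX : IsOpen X) : IsSubmanifold 0 X := fun _ hp =>
  ⟨X, hX, hp, 0, contDiffOn_const, Function.surjective_to_subsingleton _, by
    simp only [Set.inter_self, Pi.zero_apply, and_true, Set.ofPred_mem_eq]⟩

theorem tangentTo_eq_top_of_isOpen (hX : IsOpen X) (hp : p ∈ X) : tangentTo X p = ⊤ := by
  refine eq_top_iff.2 fun v _ => ?_
  exact mem_tangentTo_of_hasFDerivAt (hasFDerivAt_id p) (hX.mem_nhds hp) v

theorem finrank_amb (n : ℕ) : Module.finrank ℝ (Amb n) = n + 1 := by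
  rw [Module.finrank_prod, Module.finrank_self, finrank_euclideanSpace_fin, add_comm]

namespace IsSubmanifold

theorem exists_parametrization (hX : IsSubmanifold k X) (hp : p ∈ X) :
    ∃ (φ : tangentTo X p → Amb n) (π : Amb n →L[ℝ] tangentTo X p),
      ContDiffAt ℝ ∞ φ 0 ∧ φ 0 = p ∧ map φ (𝓝 0) = 𝓝[X] p ∧ ∀ᶠ y in 𝓝 0, π (φ y - p) = y := by
  obtain ⟨U, F, hF⟩ := isSubmanifold_iff.1 hX p hp
  obtain ⟨φ, π, hφ, hφ0, -, hmap, hπ⟩ := hF.exists_parametrization_ker hp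
  rw [hF.tangentTo_eq_ker hp]
  exact ⟨φ, π, hφ, hφ0, hmap, hπ⟩

theorem finrank_tangentTo_add (hX : IsSubmanifold k X) (hp : p ∈ X) :
    Module.finrank ℝ (tangentTo X p) + k = n + 1 := by
  obtain ⟨U, F, hF⟩ := isSubmanifold_iff.1 hX p hp
  have h := (fderiv ℝ F p : Amb n →ₗ[ℝ] Fin k → ℝ).finrank_range_add_finrank_ker
  rw [LinearMap.range_eq_top.2 hF.surjective, finrank_top, finrank_amb,
    Module.finrank_fin_fun] at h
  rw [hF.tangentTo_eq_ker hp, add_comm]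
  exact h

theorem inter_levelSet (hX : IsSubmanifold k X) {g : Amb n → ℝ} (hg : ContDiff ℝ ∞ g)
    (h : ∀ p ∈ X, g p = 0 → ∃ w ∈ tangentTo X p, fderiv ℝ g p w ≠ 0) :
    IsSubmanifold (k + 1) (X ∩ {x | g x = 0}) := by
  refine isSubmanifold_iff.2 fun p hp => ?_
  obtain ⟨U, F, hF⟩ := isSubmanifold_iff.1 hX p hp.1
  obtain ⟨w, hw, hgw⟩ := h p hp.1 hp.2
  exact ⟨U, _, hF.inter_levelSet hg hw hgw⟩

end IsSubmanifold

end Submanifold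

section Constancy

open Filter Topology

theorem eq_of_eventually_nhdsWithin_eq {Y Z : Type*} [TopologicalSpace Y] {s : Set Y}
    (hs : IsPreconnected s) {f : Y → Z} (h : ∀ x ∈ s, ∀ᶠ y in 𝓝[s] x, f y = f x) {x y : Y}
    (hx : x ∈ s) (hy : y ∈ s) : f x = f y :=
  hs.induction₂ (fun x y => f x = f y) (fun x hx => (h x hx).mono fun _ => Eq.symm)
    (fun _ _ _ _ _ _ => Eq.trans) (fun _ _ _ _ => Eq.symm) hx hy

variable {V G : Type*} [NormedAddCommGroup V] [NormedSpace ℝ V] [NormedAddCommGroup G]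
  [NormedSpace ℝ G]

theorem eventually_eq_of_eventually_hasFDerivAt_zero {f : V → G} {y : V}
    (h : ∀ᶠ z in 𝓝 y, HasFDerivAt f (0 : V →L[ℝ] G) z) : ∀ᶠ z in 𝓝 y, f z = f y := by
  obtain ⟨ε, hε, hball⟩ := Metric.eventually_nhds_iff_ball.1 h
  filter_upwards [Metric.ball_mem_nhds y hε] with z hz
  exact Metric.isOpen_ball.is_const_of_fderiv_eq_zero (𝕜 := ℝ)
    (convex_ball y ε).isPreconnected
    (fun x hx => (hball x hx).differentiableAt.differentiableWithinAt)
    (fun x hx => (hball x hx).fderiv) hz (Metric.mem_ball_self hε)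

/- The second derivative of `Ψ` is `(v, w) ↦ dμ(v) w`. Its symmetry gives `dμ(v) w = dμ(w) v`, so
`dμ(v) = 0` when `v` and `w` are linearly independent. -/
theorem hasFDerivAt_zero_of_fderiv_eq_smul_id (hV : 1 < Module.rank ℝ V) {Ψ : V → V} {μ : V → ℝ}
    {y : V} (hΨ : ContDiffAt ℝ 2 Ψ y)
    (h : ∀ᶠ z in 𝓝 y, fderiv ℝ Ψ z = μ z • ContinuousLinearMap.id ℝ V) :
    HasFDerivAt μ (0 : V →L[ℝ] ℝ) y := by
  have : Nontrivial V := rank_pos_iff_nontrivial.1 (zero_lt_one.trans hV)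
  have hΨ' : HasFDerivAt (fderiv ℝ Ψ) (fderiv ℝ (fderiv ℝ Ψ) y) y :=
    ((hΨ.fderiv_right (m := 1) (by norm_num)).differentiableAt one_ne_zero).hasFDerivAt
  have hμ : DifferentiableAt ℝ μ y := by
    obtain ⟨v, hv⟩ := exists_ne (0 : V)
    obtain ⟨ℓ, hℓ⟩ := SeparatingDual.exists_eq_one (R := ℝ) hv
    have hℓΨ : DifferentiableAt ℝ (fun z => ℓ (fderiv ℝ Ψ z v)) y := by
      have := hΨ'.differentiableAt
      fun_prop
    refine hℓΨ.congr_of_eventuallyEq (h.mono fun z hz => ?_)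
    simp [hz, hℓ]
  have hsecond : ∀ v w, fderiv ℝ (fderiv ℝ Ψ) y v w = fderiv ℝ μ y v • w := by
    intro v w
    have hμid := (hμ.hasFDerivAt.smul_const (ContinuousLinearMap.id ℝ V)).congr_of_eventuallyEq h
    rw [hΨ'.unique hμid]
    simp
  suffices hzero : fderiv ℝ μ y = 0 from hzero ▸ hμ.hasFDerivAt
  ext v
  rcases eq_or_ne v 0 with rfl | hv
  · exact map_zero _
  · obtain ⟨w, hvw⟩ := exists_linearIndependent_pair_of_one_lt_rank hV hv
    have hsymm := (hΨ.isSymmSndFDerivAt (by simp)).eq v w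
    rw [hsecond, hsecond] at hsymm
    exact (LinearIndependent.pair_iff.1 hvw (-fderiv ℝ μ y w) (fderiv ℝ μ y v)
      (by rw [hsymm, neg_smul, neg_add_cancel])).2

namespace IsSubmanifold

variable {n k : ℕ} {X : Set (Amb n)}

theorem eq_of_fderiv_eq_zero (hX : IsSubmanifold k X) (hXc : IsPreconnected X) {f : Amb n → G}
    (hf : ∀ p ∈ X, DifferentiableAt ℝ f p)
    (hf' : ∀ p ∈ X, ∀ v ∈ tangentTo X p, fderiv ℝ f p v = 0) {p q : Amb n} (hp : p ∈ X)
    (hq : q ∈ X) : f p = f q := by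
  refine eq_of_eventually_nhdsWithin_eq hXc (fun x hx => ?_) hp hq
  obtain ⟨φ, π, hφ, hφ0, hmap, -⟩ := hX.exists_parametrization hx
  have hφX : ∀ᶠ y in 𝓝 0, φ y ∈ X := hmap.le self_mem_nhdsWithin
  have hconst : ∀ᶠ y in 𝓝 0, f (φ y) = f (φ 0) := by
    refine eventually_eq_of_eventually_hasFDerivAt_zero (f := f ∘ φ) ?_
    filter_upwards [(hφ.of_le (m := 1) (by simp)).eventually (by simp), hφX.eventually_nhds]
      with y hφy hyX
    have hφ' := (hφy.differentiableAt one_ne_zero).hasFDerivAt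
    have hy := hyX.self_of_nhds
    refine ((hf _ hy).hasFDerivAt.comp y hφ').congr_fderiv ?_
    ext w
    exact hf' _ hy _ (mem_tangentTo_of_hasFDerivAt hφ' hyX w)
  rw [hφ0] at hconst
  rwa [← hmap, eventually_map]

theorem eq_of_fderiv_eq_smul (hX : IsSubmanifold k X) (hXc : IsPreconnected X) (hk : k < n)
    {f : Amb n → Amb n} {μ : Amb n → ℝ} (hf : ∀ p ∈ X, ContDiffAt ℝ 2 f p)
    (hf' : ∀ p ∈ X, ∀ v ∈ tangentTo X p, fderiv ℝ f p v = μ p • v) {p q : Amb n} (hp : p ∈ X)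
    (hq : q ∈ X) : μ p = μ q := by
  refine eq_of_eventually_nhdsWithin_eq hXc (fun x hx => ?_) hp hq
  obtain ⟨φ, π, hφ, hφ0, hmap, hπ⟩ := hX.exists_parametrization hx
  have hφ2 : ContDiffAt ℝ 2 φ 0 := contDiffAt_infty.1 hφ 2
  have hφX : ∀ᶠ y in 𝓝 0, φ y ∈ X := hmap.le self_mem_nhdsWithin
  have hrank : 1 < Module.rank ℝ (tangentTo X x) :=
    Module.one_lt_rank_of_one_lt_finrank (by have := hX.finrank_tangentTo_add hx; omega)
  have hfderiv : ∀ᶠ y in 𝓝 0,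
      fderiv ℝ (fun z => π (f (φ z))) y = μ (φ y) • ContinuousLinearMap.id ℝ _ := by
    filter_upwards [hφ2.eventually (by simp), hφX.eventually_nhds, hπ.eventually_nhds]
      with y hφy hyX hπy
    have hφ' := (hφy.differentiableAt two_ne_zero).hasFDerivAt
    have hy := hyX.self_of_nhds
    have hπφ' : π.comp (fderiv ℝ φ y) = ContinuousLinearMap.id ℝ _ :=
      (π.hasFDerivAt.comp y (hφ'.sub_const x)).unique
        ((hasFDerivAt_id y).congr_of_eventuallyEq hπy)
    have hcomp := π.hasFDerivAt.comp y
      (((hf _ hy).differentiableAt two_ne_zero).hasFDerivAt.comp y hφ')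
    refine HasFDerivAt.fderiv (hcomp.congr_fderiv ?_)
    rw [← hπφ']
    ext1 w
    simp [hf' _ hy _ (mem_tangentTo_of_hasFDerivAt hφ' hyX w)]
  have hconst : ∀ᶠ y in 𝓝 0, μ (φ y) = μ (φ 0) := by
    refine eventually_eq_of_eventually_hasFDerivAt_zero (f := μ ∘ φ) ?_
    filter_upwards [hφ2.eventually (by simp), hφX, hfderiv.eventually_nhds] with y hφy hy hfy
    exact hasFDerivAt_zero_of_fderiv_eq_smul_id hrank
      (π.contDiff.contDiffAt.comp y ((hf _ hy).comp y hφy)) hfy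
  rw [hφ0] at hconst
  rwa [← hmap, eventually_map]

end IsSubmanifold

end Constancy

section Calculus

variable {n : ℕ} {c : ℝ} {E : Type*} [NormedAddCommGroup E] [NormedSpace ℝ E] {f g : E → Amb n}
  {s : Set E} {y : E}

theorem contDiffWithinAt_quad {m : WithTop ℕ∞} (hf : ContDiffWithinAt ℝ m f s y)
    (hg : ContDiffWithinAt ℝ m g s y) :
    ContDiffWithinAt ℝ m (fun z => quad c (f z) (g z)) s y := by
  simp only [← quadL_apply]
  fun_prop

theorem contDiffWithinAt_met {m : WithTop ℕ∞} (hf : ContDiffWithinAt ℝ m f s y)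
    (hg : ContDiffWithinAt ℝ m g s y) :
    ContDiffWithinAt ℝ m (fun z => met c (f z) (g z)) s y := by
  simp only [← metL_apply]
  fun_prop

theorem contDiffAt_quad {m : WithTop ℕ∞} (hf : ContDiffAt ℝ m f y) (hg : ContDiffAt ℝ m g y) :
    ContDiffAt ℝ m (fun z => quad c (f z) (g z)) y :=
  contDiffWithinAt_quad hf hg

theorem contDiffAt_met {m : WithTop ℕ∞} (hf : ContDiffAt ℝ m f y) (hg : ContDiffAt ℝ m g y) :
    ContDiffAt ℝ m (fun z => met c (f z) (g z)) y :=
  contDiffWithinAt_met hf hg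

theorem fderivWithin_quad_apply (hf : DifferentiableWithinAt ℝ f s y)
    (hg : DifferentiableWithinAt ℝ g s y) (hs : UniqueDiffWithinAt ℝ s y) (v : E) :
    fderivWithin ℝ (fun z => quad c (f z) (g z)) s y v =
      quad c (f y) (fderivWithin ℝ g s y v) + quad c (fderivWithin ℝ f s y v) (g y) := by
  simpa [quadL_apply] using
    DFunLike.congr_fun ((quadL (n := n) c).fderivWithin_of_bilinear hf hg hs) v

theorem fderivWithin_met_apply (hf : DifferentiableWithinAt ℝ f s y)
    (hg : DifferentiableWithinAt ℝ g s y) (hs : UniqueDiffWithinAt ℝ s y) (v : E) :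
    fderivWithin ℝ (fun z => met c (f z) (g z)) s y v =
      met c (f y) (fderivWithin ℝ g s y v) + met c (fderivWithin ℝ f s y v) (g y) := by
  simpa [metL_apply] using
    DFunLike.congr_fun ((metL (n := n) c).fderivWithin_of_bilinear hf hg hs) v

theorem fderiv_quad_apply (hf : DifferentiableAt ℝ f y) (hg : DifferentiableAt ℝ g y) (v : E) :
    fderiv ℝ (fun z => quad c (f z) (g z)) y v =
      quad c (f y) (fderiv ℝ g y v) + quad c (fderiv ℝ f y v) (g y) := by
  simp only [← fderivWithin_univ]
  exact fderivWithin_quad_apply hf.differentiableWithinAt hg.differentiableWithinAt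
    uniqueDiffWithinAt_univ v

theorem fderiv_met_apply (hf : DifferentiableAt ℝ f y) (hg : DifferentiableAt ℝ g y) (v : E) :
    fderiv ℝ (fun z => met c (f z) (g z)) y v =
      met c (f y) (fderiv ℝ g y v) + met c (fderiv ℝ f y v) (g y) := by
  simp only [← fderivWithin_univ]
  exact fderivWithin_met_apply hf.differentiableWithinAt hg.differentiableWithinAt
    uniqueDiffWithinAt_univ v

end Calculus

section SpaceForm

variable {n : ℕ} {c : ℝ} {X : Set (Amb n)} {p v : Amb n}

theorem fderiv_quad_self_sub_one (p v : Amb n) :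
    fderiv ℝ (fun x => quad c x x - 1) p v = 2 * quad c p v := by
  rw [fderiv_sub_const, fderiv_quad_apply differentiableAt_fun_id differentiableAt_fun_id,
    fderiv_fun_id, ContinuousLinearMap.id_apply, quad_comm v p, two_mul]

theorem quad_eq_zero_of_mem_tangentTo (hX : X ⊆ spaceForm n c) (hv : v ∈ tangentTo X p) :
    quad c p v = 0 := by
  have h := hv (fun x => quad c x x - 1)
    ((contDiffAt_quad contDiffAt_id contDiffAt_id).sub contDiffAt_const)
    (eventually_nhdsWithin_of_forall fun x hx => sub_eq_zero.2 (hX hx).1)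
  rw [fderiv_quad_self_sub_one] at h
  linarith

theorem isSubmanifold_spaceForm (n : ℕ) (c : ℝ) : IsSubmanifold 1 (spaceForm n c) := by
  have hopen : IsOpen {x : Amb n | c ≤ 0 → 0 < x.1} := by
    by_cases hc : c ≤ 0
    · simpa only [hc, forall_const] using isOpen_lt continuous_const continuous_fst
    · simp only [hc, false_imp_iff, Set.ofPred_true, isOpen_univ]
  have heq : spaceForm n c = {x | c ≤ 0 → 0 < x.1} ∩ {x | quad c x x - 1 = 0} := by
    ext x
    simp only [spaceForm, Set.mem_inter_iff, Set.mem_ofPred_eq, sub_eq_zero, and_comm]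
  rw [heq]
  refine (isSubmanifold_zero_of_isOpen hopen).inter_levelSet
    (contDiff_iff_contDiffAt.2 fun _ =>
      (contDiffAt_quad contDiffAt_id contDiffAt_id).sub contDiffAt_const) fun p hp h => ⟨p, ?_, ?_⟩
  · rw [tangentTo_eq_top_of_isOpen hopen hp]
    exact Submodule.mem_top
  · rw [fderiv_quad_self_sub_one, sub_eq_zero.1 h]
    norm_num

theorem mem_tangentTo_spaceForm_iff (hp : p ∈ spaceForm n c) :
    v ∈ tangentTo (spaceForm n c) p ↔ quad c p v = 0 := by
  suffices h : tangentTo (spaceForm n c) p = (quadL c p : Amb n →ₗ[ℝ] ℝ).ker by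
    rw [h, LinearMap.mem_ker, ContinuousLinearMap.coe_coe, quadL_apply]
  refine Submodule.eq_of_le_of_finrank_le (fun w hw => ?_) ?_
  · rw [LinearMap.mem_ker, ContinuousLinearMap.coe_coe, quadL_apply,
      quad_eq_zero_of_mem_tangentTo subset_rfl hw]
  · have hpp : (quadL c p : Amb n →ₗ[ℝ] ℝ) p = 1 := (quadL_apply p p).trans hp.1
    have hker := Module.Dual.finrank_ker_add_one_of_ne_zero (f := (quadL c p : Amb n →ₗ[ℝ] ℝ))
      (fun h => by simp [h] at hpp)
    have hT := (isSubmanifold_spaceForm n c).finrank_tangentTo_add hp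
    rw [finrank_amb] at hker
    omega

end SpaceForm

section UnitNormal

variable {n k : ℕ} {c : ℝ}

/-- The vector `m` is a unit normal, for the metric `met c`, of the hyperplane `K` of the space `T`.
In the applications `T` and `K` are the tangent spaces of a submanifold and of a hypersurface of
it. -/
structure IsUnitNormal (c : ℝ) (T K : Submodule ℝ (Amb n)) (m : Amb n) : Prop where
  mem : m ∈ T
  unit : met c m m = 1
  mem_iff : ∀ v, v ∈ K ↔ v ∈ T ∧ met c m v = 0

theorem IsUnitNormal.of_finrank_le {T K : Submodule ℝ (Amb n)} {m : Amb n} (hm : m ∈ T)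
    (hm1 : met c m m = 1) (hK : ∀ v ∈ K, v ∈ T ∧ met c m v = 0)
    (hrank : Module.finrank ℝ T ≤ Module.finrank ℝ K + 1) : IsUnitNormal c T K m := by
  let f : T →ₗ[ℝ] ℝ := (metL c m : Amb n →ₗ[ℝ] ℝ) ∘ₗ T.subtype
  have hf : ∀ v : T, f v = met c m v := fun v => metL_apply m v
  have hf0 : f ≠ 0 := fun h => by simpa [h, hm1] using hf ⟨m, hm⟩
  have hker : Module.finrank ℝ (f.ker.map T.subtype) + 1 = Module.finrank ℝ T := by
    rw [Submodule.finrank_map_subtype_eq, Module.Dual.finrank_ker_add_one_of_ne_zero hf0]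
  have hmem : ∀ v, v ∈ f.ker.map T.subtype ↔ v ∈ T ∧ met c m v = 0 := by
    simp [Submodule.mem_map, hf, and_comm]
  have hKf : K = f.ker.map T.subtype :=
    Submodule.eq_of_le_of_finrank_le (fun v hv => (hmem v).2 (hK v hv)) (by omega)
  exact ⟨hm, hm1, hKf ▸ hmem⟩

theorem IsUmbilicalHypersurface.isUnitNormal {W X : Set (Amb n)} {P : Amb n → Amb n → Amb n}
    {η : Amb n → Amb n} (hX : IsUmbilicalHypersurface c W P (k + 1) X η) (hW : IsSubmanifold k W)
    {p : Amb n} (hp : p ∈ X) : IsUnitNormal c (tangentTo W p) (tangentTo X p) (η p) := by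
  refine .of_finrank_le (hX.tangent p hp) (hX.unit p hp)
    (fun v hv => ⟨tangentTo_mono hX.subset hv, hX.normal p hp v hv⟩) ?_
  have hXrank := hX.submanifold.finrank_tangentTo_add hp
  have hWrank := hW.finrank_tangentTo_add (hX.subset hp)
  omega

end UnitNormal

section Umbilical

variable {n : ℕ} {c : ℝ} {M : Set (Amb n)} {ξ : Amb n → Amb n} {p v : Amb n}

theorem projN_of_tangent (hv : quad c p v = 0) : projN c p v = v := by
  rw [projN, hv, zero_smul, sub_zero]

namespace IsUmbilicalHypersurface

theorem differentiableAt (hM : IsUmbilicalHypersurface c (spaceForm n c) (projN c) 2 M ξ)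
    (hp : p ∈ M) : DifferentiableAt ℝ ξ p :=
  (hM.smooth p hp).differentiableAt (by simp)

theorem quad_normal (hM : IsUmbilicalHypersurface c (spaceForm n c) (projN c) 2 M ξ)
    (hp : p ∈ M) : quad c p (ξ p) = 0 :=
  quad_eq_zero_of_mem_tangentTo subset_rfl (hM.tangent p hp)

theorem quad_tangent (hM : IsUmbilicalHypersurface c (spaceForm n c) (projN c) 2 M ξ)
    (hv : v ∈ tangentTo M p) : quad c p v = 0 :=
  quad_eq_zero_of_mem_tangentTo hM.subset hv

theorem quad_fderiv_normal (hM : IsUmbilicalHypersurface c (spaceForm n c) (projN c) 2 M ξ)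
    (hp : p ∈ M) (hv : v ∈ tangentTo M p) : quad c p (fderiv ℝ ξ p v) = 0 := by
  have h := hv (fun x => quad c x (ξ x)) (contDiffAt_quad contDiffAt_id (hM.smooth p hp))
    (eventually_nhdsWithin_of_forall fun x hx => hM.quad_normal hx)
  rwa [fderiv_quad_apply differentiableAt_fun_id (hM.differentiableAt hp), fderiv_fun_id,
    ContinuousLinearMap.id_apply,
    quad_eq_mul_met_of_tangent (hM.subset hp) (hM.quad_tangent hv), met_comm v,
    hM.normal p hp v hv, mul_zero, add_zero] at h

theorem exists_fderiv_normal (hM : IsUmbilicalHypersurface c (spaceForm n c) (projN c) 2 M ξ)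
    (hp : p ∈ M) : ∃ l : ℝ, ∀ v ∈ tangentTo M p, fderiv ℝ ξ p v = -(l • v) := by
  obtain ⟨l, hl⟩ := hM.umbilic p hp
  refine ⟨l, fun v hv => ?_⟩
  rw [← hl v hv, projN_of_tangent (hM.quad_fderiv_normal hp hv)]

theorem exists_const_curvature (hM : IsUmbilicalHypersurface c (spaceForm n c) (projN c) 2 M ξ)
    (hMc : IsPreconnected M) (hn : 3 ≤ n) :
    ∃ l : ℝ, ∀ p ∈ M, ∀ v ∈ tangentTo M p, fderiv ℝ ξ p v = -(l • v) := by
  rcases M.eq_empty_or_nonempty with rfl | ⟨q, hq⟩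
  · exact ⟨0, by simp⟩
  choose! l hl using fun p (hp : p ∈ M) => hM.exists_fderiv_normal hp
  refine ⟨l q, fun p hp v hv => ?_⟩
  have hconst : -l p = -l q := hM.submanifold.eq_of_fderiv_eq_smul hMc hn
    (fun x hx => contDiffAt_infty.1 (hM.smooth x hx) 2)
    (fun x hx v hv => (hl x hx v hv).trans (neg_smul _ _).symm) hp hq
  rw [hl p hp v hv, neg_injective hconst]

/- In Euclidean space this says that `M` is a piece of a hyperplane (`l = 0`) or of a sphere about
`p + l⁻¹ • ξ p`. -/
theorem met_sub_normal_add_eq (hM : IsUmbilicalHypersurface c (spaceForm n c) (projN c) 2 M ξ)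
    (hMc : IsPreconnected M) {l : ℝ}
    (hl : ∀ p ∈ M, ∀ v ∈ tangentTo M p, fderiv ℝ ξ p v = -(l • v)) (o : Amb n) {p q : Amb n}
    (hp : p ∈ M) (hq : q ∈ M) :
    met c (p - o) (ξ p) + l / 2 * met c (p - o) (p - o) =
      met c (q - o) (ξ q) + l / 2 * met c (q - o) (q - o) := by
  have hsub : ∀ x, DifferentiableAt ℝ (fun x => x - o) x := fun x => by fun_prop
  have hlin : ∀ x ∈ M, DifferentiableAt ℝ (fun x => met c (x - o) (ξ x)) x := fun x hx =>
    (contDiffAt_met (m := 1) (by fun_prop)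
      ((hM.smooth x hx).of_le (by simp))).differentiableAt one_ne_zero
  have hsq : ∀ x, DifferentiableAt ℝ (fun x => met c (x - o) (x - o)) x := fun x =>
    (contDiffAt_met (m := 1) (by fun_prop) (by fun_prop)).differentiableAt one_ne_zero
  refine hM.submanifold.eq_of_fderiv_eq_zero hMc
    (f := fun x => met c (x - o) (ξ x) + l / 2 * met c (x - o) (x - o))
    (fun x hx => (hlin x hx).add ((hsq x).const_mul _)) (fun x hx v hv => ?_) hp hq
  rw [fderiv_fun_add (hlin x hx) ((hsq x).const_mul _), fderiv_const_mul (hsq x)]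
  simp only [add_apply, smul_apply, smul_eq_mul,
    fderiv_met_apply (hsub x) (hM.differentiableAt hx), fderiv_met_apply (hsub x) (hsub x),
    fderiv_sub_const, fderiv_fun_id, ContinuousLinearMap.id_apply, hl x hx v hv, met_neg_right,
    met_smul_right, met_comm v, hM.normal x hx v hv]
  ring

end IsUmbilicalHypersurface

end Umbilical

section GeodesicSphere

variable {n : ℕ} {c : ℝ} {o : Amb n} {r : ℝ} {x v : Amb n}

/-- The squared length, for the metric `met c`, of the chords in `ℝ × ℝⁿ` that join the centre `o`
of a geodesic sphere of radius `r` to its points. -/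
noncomputable def chordSq (c : ℝ) (o : Amb n) (r : ℝ) : ℝ :=
  (cs c r - 1) ^ 2 * met c o o + sn c r ^ 2

/-- The equation that cuts the geodesic sphere out of the space form, as a function of the points of
`ℝ × ℝⁿ`. It does not degenerate at `c = 0`, unlike `quad c o x = cs c r`. -/
noncomputable def chordFun (c : ℝ) (o : Amb n) (r : ℝ) (x : Amb n) : ℝ :=
  met c (x - o) (x - o) - chordSq c o r

theorem chordFun_eq_zero_iff : chordFun c o r x = 0 ↔ met c (x - o) (x - o) = chordSq c o r :=
  sub_eq_zero

theorem contDiff_chordFun : ContDiff ℝ ∞ (chordFun c o r) :=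
  contDiff_iff_contDiffAt.2 fun _ =>
    (contDiffAt_met (by fun_prop) (by fun_prop)).sub contDiffAt_const

theorem fderiv_chordFun (x v : Amb n) : fderiv ℝ (chordFun c o r) x v = 2 * met c (x - o) v := by
  have hsub : DifferentiableAt ℝ (fun y => y - o) x := by fun_prop
  unfold chordFun
  rw [fderiv_sub_const, fderiv_met_apply hsub hsub, fderiv_sub_const, fderiv_fun_id,
    ContinuousLinearMap.id_apply, met_comm v, two_mul]

theorem fst_pos_of_quad_pos (hc : c ≤ 0) (ho : o ∈ spaceForm n c) (hx : quad c x x = 1)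
    (hox : 0 < quad c o x) : 0 < x.1 := by
  have ho1 : 0 < o.1 := ho.2 hc
  have hoo : quad c o o = 1 := ho.1
  simp only [quad, real_inner_self_eq_norm_sq] at hoo hx hox
  by_contra! hx1
  have hneg : o.1 * x.1 ≤ 0 := mul_nonpos_of_nonneg_of_nonpos ho1.le hx1
  have hlt : (o.1 * x.1) ^ 2 < (c * inner ℝ o.2 x.2) ^ 2 := by nlinarith
  have hcs : (c * inner ℝ o.2 x.2) ^ 2 ≤ (c * ‖o.2‖ ^ 2) * (c * ‖x.2‖ ^ 2) := by
    have hinner : inner ℝ o.2 x.2 ^ 2 ≤ (‖o.2‖ * ‖x.2‖) ^ 2 :=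
      sq_le_sq' (neg_le_of_abs_le (abs_real_inner_le_norm _ _)) (real_inner_le_norm _ _)
    nlinarith [mul_le_mul_of_nonneg_left hinner (sq_nonneg c)]
  have ho2 : 0 ≤ -c * ‖o.2‖ ^ 2 := by have := neg_nonneg.2 hc; positivity
  have hx2 : 0 ≤ -c * ‖x.2‖ ^ 2 := by have := neg_nonneg.2 hc; positivity
  nlinarith

theorem one_sub_cs_mul_met (hv : quad c x v = 0) : (1 - cs c r) * met c x v = 0 := by
  rcases eq_zero_or_met_eq_zero hv with rfl | h
  · rw [cs_zero_left, sub_self, zero_mul]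
  · rw [h, mul_zero]

theorem quad_geod_self (ho : o ∈ spaceForm n c) (hv : v ∈ unitTangent c o) :
    quad c (geod c o v r) (geod c o v r) = 1 := by
  have hvv : quad c v v = c := by rw [quad_eq_mul_met_of_tangent ho hv.1, hv.2, mul_one]
  simp only [geod, quad_add_left, quad_add_right, quad_smul_left, quad_smul_right, hvv, ho.1,
    hv.1, quad_comm v o]
  linarith [cs_sq_add_mul_sn_sq c r]

theorem quad_geod (ho : o ∈ spaceForm n c) (hv : v ∈ unitTangent c o) :
    quad c o (geod c o v r) = cs c r := by
  rw [geod, quad_add_right, quad_smul_right, quad_smul_right, ho.1, hv.1]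
  ring

theorem chordFun_geod (hv : v ∈ unitTangent c o) : chordFun c o r (geod c o v r) = 0 := by
  have hsub : geod c o v r - o = (cs c r - 1) • o + sn c r • v := by rw [geod]; module
  rw [chordFun_eq_zero_iff, hsub, chordSq]
  simp only [met_add_left, met_add_right, met_smul_left, met_smul_right, hv.2, met_comm v o]
  linear_combination (-2 * sn c r) * one_sub_cs_mul_met (r := r) hv.1

theorem geodSphere_subset_spaceForm (ho : o ∈ spaceForm n c) :
    geodSphere c o r ⊆ spaceForm n c := by
  rintro _ ⟨v, hv, rfl⟩
  refine ⟨quad_geod_self ho hv, fun hc => fst_pos_of_quad_pos hc ho (quad_geod_self ho hv) ?_⟩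
  rw [quad_geod ho hv]
  exact zero_lt_one.trans_le (one_le_cs hc r)

theorem quad_eq_cs (ho : o ∈ spaceForm n c) (hx : x ∈ spaceForm n c)
    (h : chordFun c o r x = 0) : quad c o x = cs c r := by
  rcases eq_or_ne c 0 with rfl | hc
  · rw [cs_zero_left, quad, fst_eq_one ho, fst_eq_one hx, mul_one, zero_mul, add_zero]
  · have hoo : c * met c o o = 1 := (quad_eq_mul_met hc o o).symm.trans ho.1
    have hxx : c * met c x x = 1 := (quad_eq_mul_met hc x x).symm.trans hx.1
    rw [quad_eq_mul_met hc]
    simp only [chordFun, chordSq, met_sub_left, met_sub_right, met_comm x o] at h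
    linear_combination (-c / 2) * h + hxx / 2 + (1 - (cs c r - 1) ^ 2) / 2 * hoo -
      cs_sq_add_mul_sn_sq c r / 2

/- Both `cs c r • x - o` and `x - cs c r • o` are orthogonal projections of the chord `x - o`, so
their lengths agree with the one computed at `x = geod c o v r`. -/
theorem met_cs_smul_sub_self (ho : o ∈ spaceForm n c) (hx : x ∈ spaceForm n c)
    (h : chordFun c o r x = 0) :
    met c (x - cs c r • o) (x - cs c r • o) = sn c r ^ 2 ∧
      met c (cs c r • x - o) (cs c r • x - o) = sn c r ^ 2 := by
  rcases eq_or_ne c 0 with rfl | hc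
  · rw [chordFun_eq_zero_iff, chordSq, cs_zero_left] at h
    simp [h, cs_zero_left]
  · have hoo : c * met c o o = 1 := (quad_eq_mul_met hc o o).symm.trans ho.1
    have hxx : c * met c x x = 1 := (quad_eq_mul_met hc x x).symm.trans hx.1
    have hox : c * met c o x = cs c r := (quad_eq_mul_met hc o x).symm.trans (quad_eq_cs ho hx h)
    have htrig := cs_sq_add_mul_sn_sq c r
    simp only [met_sub_left, met_sub_right, met_smul_left, met_smul_right, met_comm x o]
    constructor <;> refine mul_left_cancel₀ hc ?_
    · linear_combination hxx - 2 * cs c r * hox + cs c r ^ 2 * hoo - htrig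
    · linear_combination cs c r ^ 2 * hxx - 2 * cs c r * hox + hoo - htrig

theorem geodSphere_eq_inter (ho : o ∈ spaceForm n c) (hs : 0 < sn c r) :
    geodSphere c o r = spaceForm n c ∩ {x | chordFun c o r x = 0} := by
  refine subset_antisymm (Set.subset_inter (geodSphere_subset_spaceForm ho) ?_) ?_
  · rintro _ ⟨v, hv, rfl⟩
    exact chordFun_geod hv
  · rintro x ⟨hx, h⟩
    have hoo : quad c o o = 1 := ho.1
    refine ⟨(sn c r)⁻¹ • (x - cs c r • o), ⟨?_, ?_⟩, ?_⟩
    · rw [quad_smul_right, quad_sub_right, quad_smul_right, quad_eq_cs ho hx h, hoo, mul_one,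
        sub_self, mul_zero]
    · rw [met_smul_left, met_smul_right, (met_cs_smul_sub_self ho hx h).1]
      field_simp
    · rw [geod, smul_inv_smul₀ hs.ne', add_sub_cancel]

theorem met_outNormal (hv : quad c x v = 0) :
    met c (outNormal c o r x) v = (sn c r)⁻¹ * met c (x - o) v := by
  rw [outNormal, met_smul_left, met_sub_left, met_sub_left, met_smul_left]
  linear_combination (-(sn c r)⁻¹) * one_sub_cs_mul_met (r := r) hv

theorem fderiv_chordFun_of_tangent (hs : 0 < sn c r) (hv : quad c x v = 0) :
    fderiv ℝ (chordFun c o r) x v = 2 * sn c r * met c (outNormal c o r x) v := by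
  rw [fderiv_chordFun, met_outNormal hv]
  field_simp

theorem quad_outNormal (ho : o ∈ spaceForm n c) (hx : x ∈ spaceForm n c)
    (h : chordFun c o r x = 0) : quad c x (outNormal c o r x) = 0 := by
  have hxx : quad c x x = 1 := hx.1
  rw [outNormal, quad_smul_right, quad_sub_right, quad_smul_right, hxx, quad_comm x o,
    quad_eq_cs ho hx h, mul_one, sub_self, mul_zero]

theorem met_outNormal_self (hs : 0 < sn c r) (ho : o ∈ spaceForm n c) (hx : x ∈ spaceForm n c)
    (h : chordFun c o r x = 0) : met c (outNormal c o r x) (outNormal c o r x) = 1 := by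
  rw [outNormal, met_smul_left, met_smul_right, (met_cs_smul_sub_self ho hx h).2]
  field_simp

theorem fderiv_outNormal (x v : Amb n) :
    fderiv ℝ (outNormal c o r) x v = ((sn c r)⁻¹ * cs c r) • v := by
  have h := (((hasFDerivAt_id (𝕜 := ℝ) x).const_smul (cs c r)).sub_const o).const_smul (sn c r)⁻¹
  rw [show fderiv ℝ (outNormal c o r) x = _ from h.fderiv]
  simp only [smul_apply, ContinuousLinearMap.id_apply, smul_smul]

theorem isUmbilicalHypersurface_geodSphere (hs : 0 < sn c r) (ho : o ∈ spaceForm n c) :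
    IsUmbilicalHypersurface c (spaceForm n c) (projN c) 2 (geodSphere c o r)
      (outNormal c o r) where
  subset := geodSphere_subset_spaceForm ho
  submanifold := by
    rw [geodSphere_eq_inter ho hs]
    refine (isSubmanifold_spaceForm n c).inter_levelSet contDiff_chordFun fun x hx h =>
      ⟨outNormal c o r x, (mem_tangentTo_spaceForm_iff hx).2 (quad_outNormal ho hx h), ?_⟩
    rw [fderiv_chordFun_of_tangent hs (quad_outNormal ho hx h), met_outNormal_self hs ho hx h]
    positivity
  smooth x _ := by unfold outNormal; fun_prop
  tangent x hx := by
    rw [geodSphere_eq_inter ho hs] at hx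
    exact (mem_tangentTo_spaceForm_iff hx.1).2 (quad_outNormal ho hx.1 hx.2)
  unit x hx := by
    rw [geodSphere_eq_inter ho hs] at hx
    exact met_outNormal_self hs ho hx.1 hx.2
  normal x _ v hv := by
    have hv0 := quad_eq_zero_of_mem_tangentTo (geodSphere_subset_spaceForm ho) hv
    have h := hv _ contDiff_chordFun.contDiffAt <| eventually_nhdsWithin_of_forall fun y hy =>
      ((geodSphere_eq_inter ho hs).subset hy).2
    rw [fderiv_chordFun_of_tangent hs hv0] at h
    exact (mul_eq_zero.1 h).resolve_left (by positivity)
  umbilic x _ := by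
    refine ⟨-((sn c r)⁻¹ * cs c r), fun v hv => ?_⟩
    have hv0 := quad_eq_zero_of_mem_tangentTo (geodSphere_subset_spaceForm ho) hv
    rw [fderiv_outNormal, projN_of_tangent (by rw [quad_smul_right, hv0, mul_zero]), neg_smul,
      neg_neg]

end GeodesicSphere

section Intersection

variable {n : ℕ} {c : ℝ} {M N : Set (Amb n)} {ξ η : Amb n → Amb n} {κ : ℝ} {x v : Amb n}

theorem projM_of_tangent (hv : quad c x v = 0) (hξ : met c (ξ x) v = 0) :
    projM c ξ x v = v := by
  rw [projM, projN_of_tangent hv, met_comm v, hξ, zero_smul, sub_zero]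

/-- The unit normal inside `M` of the intersection of two hypersurfaces `M` and `N` of the space
form with unit normals `ξ` and `η` such that `⟨η, ξ⟩ = κ`: the normalized component of `η`
orthogonal to `ξ`. -/
noncomputable def interNormal (ξ η : Amb n → Amb n) (κ : ℝ) (x : Amb n) : Amb n :=
  (√(1 - κ ^ 2))⁻¹ • (η x - κ • ξ x)

theorem met_interNormal (hv : met c (ξ x) v = 0) :
    met c (interNormal ξ η κ x) v = met c (η x) v / √(1 - κ ^ 2) := by
  rw [interNormal, met_smul_left, met_sub_left, met_smul_left, hv, mul_zero, sub_zero,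
    div_eq_inv_mul]

namespace IsUmbilicalHypersurface

theorem sub_smul_normal_mem (hM : IsUmbilicalHypersurface c (spaceForm n c) (projN c) 2 M ξ)
    (hN : IsUmbilicalHypersurface c (spaceForm n c) (projN c) 2 N η) (hxM : x ∈ M) (hxN : x ∈ N)
    (hκ : met c (η x) (ξ x) = κ) : η x - κ • ξ x ∈ tangentTo M x := by
  refine ((hM.isUnitNormal (isSubmanifold_spaceForm n c) hxM).mem_iff _).2 ⟨?_, ?_⟩
  · exact Submodule.sub_mem _ (hN.tangent x hxN) (Submodule.smul_mem _ _ (hM.tangent x hxM))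
  · rw [met_sub_right, met_smul_right, hM.unit x hxM, met_comm, hκ, mul_one, sub_self]

theorem met_sub_smul_normal (hN : IsUmbilicalHypersurface c (spaceForm n c) (projN c) 2 N η)
    (hxN : x ∈ N) (hκ : met c (η x) (ξ x) = κ) : met c (η x) (η x - κ • ξ x) = 1 - κ ^ 2 := by
  rw [met_sub_right, met_smul_right, hN.unit x hxN, hκ, sq]

theorem inter (hM : IsUmbilicalHypersurface c (spaceForm n c) (projN c) 2 M ξ)
    (hN : IsUmbilicalHypersurface c (spaceForm n c) (projN c) 2 N η)
    (hMN : IsSubmanifold 3 (M ∩ N)) (hκ1 : κ ^ 2 < 1)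
    (hκ : ∀ x ∈ M ∩ N, met c (η x) (ξ x) = κ) :
    IsUmbilicalHypersurface c M (projM c ξ) 3 (M ∩ N) (interNormal ξ η κ) where
  subset := Set.inter_subset_left
  submanifold := hMN
  smooth x hx := ((hN.smooth x hx.2).sub ((hM.smooth x hx.1).const_smul κ)).const_smul _
  tangent x hx := Submodule.smul_mem _ _ (hM.sub_smul_normal_mem hN hx.1 hx.2 (hκ x hx))
  unit x hx := by
    have hmem := hM.sub_smul_normal_mem hN hx.1 hx.2 (hκ x hx)
    have hpos : 0 < 1 - κ ^ 2 := sub_pos.2 hκ1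
    have hort : met c (ξ x) (interNormal ξ η κ x) = 0 := by
      rw [interNormal, met_smul_right, hM.normal x hx.1 _ hmem, mul_zero]
    rw [met_interNormal hort, interNormal, met_smul_right, hN.met_sub_smul_normal hx.2 (hκ x hx),
      inv_mul_eq_div, div_div, Real.mul_self_sqrt hpos.le, div_self hpos.ne']
  normal x hx v hv := by
    rw [met_interNormal (hM.normal x hx.1 v (tangentTo_mono Set.inter_subset_left hv)),
      hN.normal x hx.2 v (tangentTo_mono Set.inter_subset_right hv), zero_div]
  umbilic x hx := by
    obtain ⟨l, hl⟩ := hM.exists_fderiv_normal hx.1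
    obtain ⟨m, hm⟩ := hN.exists_fderiv_normal hx.2
    refine ⟨(√(1 - κ ^ 2))⁻¹ * (m - κ * l), fun v hv => ?_⟩
    have hvM := tangentTo_mono Set.inter_subset_left hv
    have hfderiv := ((hN.differentiableAt hx.2).hasFDerivAt.sub
      ((hM.differentiableAt hx.1).hasFDerivAt.const_smul κ)).const_smul (√(1 - κ ^ 2))⁻¹
    have hv' : fderiv ℝ (interNormal ξ η κ) x v = -(((√(1 - κ ^ 2))⁻¹ * (m - κ * l)) • v) := by
      rw [show fderiv ℝ (interNormal ξ η κ) x = _ from hfderiv.fderiv]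
      simp only [smul_apply, sub_apply, hl v hvM,
        hm v (tangentTo_mono Set.inter_subset_right hv)]
      module
    rw [hv', ← neg_smul, projM_of_tangent]
    · rw [quad_smul_right, hM.quad_tangent hvM, mul_zero]
    · rw [met_smul_right, hM.normal x hx.1 v hvM, mul_zero]

variable {o : Amb n} {r : ℝ}

theorem isSubmanifold_inter_geodSphere
    (hM : IsUmbilicalHypersurface c (spaceForm n c) (projN c) 2 M ξ) (hs : 0 < sn c r)
    (ho : o ∈ spaceForm n c) (hκ1 : κ ^ 2 < 1)
    (hκ : ∀ x ∈ M ∩ geodSphere c o r, met c (outNormal c o r x) (ξ x) = κ) :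
    IsSubmanifold 3 (M ∩ geodSphere c o r) := by
  have hN := isUmbilicalHypersurface_geodSphere hs ho
  have heq : M ∩ geodSphere c o r = M ∩ {x | chordFun c o r x = 0} := by
    rw [geodSphere_eq_inter ho hs, ← Set.inter_assoc, Set.inter_eq_left.2 hM.subset]
  rw [heq]
  refine hM.submanifold.inter_levelSet contDiff_chordFun fun x hxM hx => ?_
  have hxS : x ∈ geodSphere c o r := (heq.symm.subset ⟨hxM, hx⟩).2
  have hmem := hM.sub_smul_normal_mem hN hxM hxS (hκ x ⟨hxM, hxS⟩)
  refine ⟨_, hmem, ?_⟩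
  rw [fderiv_chordFun_of_tangent hs (hM.quad_tangent hmem),
    hN.met_sub_smul_normal hxS (hκ x ⟨hxM, hxS⟩)]
  exact mul_ne_zero (by positivity) (sub_pos.2 hκ1).ne'

theorem exists_met_outNormal_eq
    (hM : IsUmbilicalHypersurface c (spaceForm n c) (projN c) 2 M ξ) (hMc : IsPreconnected M)
    {l : ℝ} (hl : ∀ p ∈ M, ∀ v ∈ tangentTo M p, fderiv ℝ ξ p v = -(l • v))
    (hs : 0 < sn c r) (ho : o ∈ spaceForm n c) :
    ∃ κ : ℝ, ∀ x ∈ M ∩ geodSphere c o r, met c (outNormal c o r x) (ξ x) = κ := by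
  rcases (M ∩ geodSphere c o r).eq_empty_or_nonempty with hempty | ⟨q, hq⟩
  · exact ⟨0, by simp [hempty]⟩
  refine ⟨met c (outNormal c o r q) (ξ q), fun x hx => ?_⟩
  have hchord : ∀ y ∈ geodSphere c o r, met c (y - o) (y - o) = chordSq c o r := fun y hy =>
    chordFun_eq_zero_iff.1 ((geodSphere_eq_inter ho hs).subset hy).2
  have h := hM.met_sub_normal_add_eq hMc hl o hx.1 hq.1
  rw [hchord x hx.2, hchord q hq.2, add_left_inj] at h
  rw [met_outNormal (hM.quad_normal hx.1), met_outNormal (hM.quad_normal hq.1), h]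

end IsUmbilicalHypersurface

end Intersection

section Perp

variable {n : ℕ} {c : ℝ}

theorem perp_add (a b z w : Amb n) : perp c a b (z + w) = perp c a b z + perp c a b w := by
  simp only [perp, met_add_left]
  module

theorem perp_smul (s : ℝ) (a b z : Amb n) : perp c a b (s • z) = s • perp c a b z := by
  simp only [perp, met_smul_left]
  module

theorem perp_of_orthogonal {a b z : Amb n} (ha : met c z a = 0) (hb : met c z b = 0) :
    perp c a b z = z := by
  simp only [perp, ha, hb, mul_zero, sub_zero, zero_smul, add_zero, smul_zero]

theorem perp_left {a b : Amb n} (h : gramDet c a b ≠ 0) : perp c a b a = 0 := by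
  have h' : met c b b * met c a a - met c a b * met c a b = gramDet c a b := by
    rw [gramDet]
    ring
  rw [perp, h', mul_comm (met c a b), sub_self, zero_smul, add_zero, smul_smul, ← gramDet,
    inv_mul_cancel₀ h, one_smul, sub_self]

theorem perp_right {a b : Amb n} (h : gramDet c a b ≠ 0) : perp c a b b = 0 := by
  rw [perp, met_comm b a, mul_comm (met c a b) (met c b b), sub_self, zero_smul, zero_add,
    smul_smul, ← sq, ← gramDet, inv_mul_cancel₀ h, one_smul, sub_self]

theorem met_perp_of_orthogonal {a b m : Amb n} (ha : met c a m = 0) (hb : met c b m = 0)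
    (z : Amb n) : met c (perp c a b z) m = met c z m := by
  simp only [perp, met_sub_left, met_smul_left, met_add_left, ha, hb, mul_zero, add_zero, sub_zero]

theorem projM_add (ξ : Amb n → Amb n) (x z w : Amb n) :
    projM c ξ x (z + w) = projM c ξ x z + projM c ξ x w := by
  simp only [projM, projN, quad_add_right, met_sub_left, met_add_left, met_smul_left]
  module

variable {E : Type*} [NormedAddCommGroup E] [NormedSpace ℝ E] {a b z : E → Amb n} {s : Set E}
  {y : E} {m : WithTop ℕ∞}

theorem contDiffWithinAt_gramDet (ha : ContDiffWithinAt ℝ m a s y)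
    (hb : ContDiffWithinAt ℝ m b s y) :
    ContDiffWithinAt ℝ m (fun x => gramDet c (a x) (b x)) s y :=
  ((contDiffWithinAt_met ha ha).mul (contDiffWithinAt_met hb hb)).sub
    ((contDiffWithinAt_met ha hb).pow 2)

theorem contDiffWithinAt_perp (ha : ContDiffWithinAt ℝ m a s y) (hb : ContDiffWithinAt ℝ m b s y)
    (hz : ContDiffWithinAt ℝ m z s y) (hG : gramDet c (a y) (b y) ≠ 0) :
    ContDiffWithinAt ℝ m (fun x => perp c (a x) (b x) (z x)) s y := by
  have haa := contDiffWithinAt_met (c := c) ha ha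
  have hab := contDiffWithinAt_met (c := c) ha hb
  have hbb := contDiffWithinAt_met (c := c) hb hb
  have hza := contDiffWithinAt_met (c := c) hz ha
  have hzb := contDiffWithinAt_met (c := c) hz hb
  exact hz.sub (((contDiffWithinAt_gramDet ha hb).inv hG).smul
    ((((hbb.mul hza).sub (hab.mul hzb)).smul ha).add (((haa.mul hzb).sub (hab.mul hza)).smul hb)))

theorem contDiffWithinAt_projN (ha : ContDiffWithinAt ℝ m a s y)
    (hz : ContDiffWithinAt ℝ m z s y) :
    ContDiffWithinAt ℝ m (fun x => projN c (a x) (z x)) s y :=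
  hz.sub ((contDiffWithinAt_quad ha hz).smul ha)

end Perp

section PartialDerivative

open Filter Topology Set

variable {F : Type*} [NormedAddCommGroup F] [NormedSpace ℝ F] {y : EuclideanSpace ℝ (Fin 2)}

theorem contDiffWithinAt_pd {f : EuclideanSpace ℝ (Fin 2) → F} {m k : WithTop ℕ∞}
    (hf : ContDiffWithinAt ℝ k f (range (𝓡∂ 2)) y) (hmk : m + 1 ≤ k) (hy : y ∈ range (𝓡∂ 2))
    (i : Fin 2) : ContDiffWithinAt ℝ m (pd i f) (range (𝓡∂ 2)) y :=
  (hf.fderivWithin_right (𝓡∂ 2).uniqueDiffOn hmk hy).clm_apply contDiffWithinAt_const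

theorem eventually_contDiffWithinAt {f : EuclideanSpace ℝ (Fin 2) → F} {m : ℕ}
    (hf : ContDiffWithinAt ℝ m f (range (𝓡∂ 2)) y) (hy : y ∈ range (𝓡∂ 2)) :
    ∀ᶠ z in 𝓝[range (𝓡∂ 2)] y, ContDiffWithinAt ℝ m f (range (𝓡∂ 2)) z := by
  simpa only [insert_eq_of_mem hy] using hf.eventually (by simp)

theorem pd_eq_zero_of_eventually {f : EuclideanSpace ℝ (Fin 2) → F}
    (hf : ∀ᶠ z in 𝓝[range (𝓡∂ 2)] y, f z = 0) (hy : y ∈ range (𝓡∂ 2)) (i : Fin 2) :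
    pd i f y = 0 := by
  have hf0 : f =ᶠ[𝓝[range (𝓡∂ 2)] y] fun _ => 0 := hf
  rw [pd, hf0.fderivWithin_eq_of_mem hy, fderivWithin_const_apply, zero_apply]

theorem pd_comp {G : Type*} [NormedAddCommGroup G] [NormedSpace ℝ G]
    {f : EuclideanSpace ℝ (Fin 2) → F} {h : F → G} (hh : DifferentiableAt ℝ h (f y))
    (hf : DifferentiableWithinAt ℝ f (range (𝓡∂ 2)) y) (hy : y ∈ range (𝓡∂ 2)) (i : Fin 2) :
    pd i (fun z => h (f z)) y = fderiv ℝ h (f y) (pd i f y) := by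
  have hcomp := hh.hasFDerivAt.comp_hasFDerivWithinAt y hf.hasFDerivWithinAt
  exact DFunLike.congr_fun (hcomp.fderivWithin ((𝓡∂ 2).uniqueDiffOn y hy)) _

variable {n : ℕ} {c : ℝ} {f g : EuclideanSpace ℝ (Fin 2) → Amb n}

theorem pd_met (hf : DifferentiableWithinAt ℝ f (range (𝓡∂ 2)) y)
    (hg : DifferentiableWithinAt ℝ g (range (𝓡∂ 2)) y) (hy : y ∈ range (𝓡∂ 2)) (i : Fin 2) :
    pd i (fun z => met c (f z) (g z)) y = met c (f y) (pd i g y) + met c (pd i f y) (g y) :=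
  fderivWithin_met_apply hf hg ((𝓡∂ 2).uniqueDiffOn y hy) _

theorem pd_quad (hf : DifferentiableWithinAt ℝ f (range (𝓡∂ 2)) y)
    (hg : DifferentiableWithinAt ℝ g (range (𝓡∂ 2)) y) (hy : y ∈ range (𝓡∂ 2)) (i : Fin 2) :
    pd i (fun z => quad c (f z) (g z)) y = quad c (f y) (pd i g y) + quad c (pd i f y) (g y) :=
  fderivWithin_quad_apply hf hg ((𝓡∂ 2).uniqueDiffOn y hy) _

theorem pd_mem_tangentTo {X : Set (Amb n)} (hfX : ∀ z, f z ∈ X)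
    (hf : DifferentiableWithinAt ℝ f (range (𝓡∂ 2)) y) (hy : y ∈ range (𝓡∂ 2)) (i : Fin 2) :
    pd i f y ∈ tangentTo X (f y) :=
  mem_tangentTo_of_hasFDerivWithinAt hf.hasFDerivWithinAt ((𝓡∂ 2).uniqueDiffOn y hy) hy
    (Eventually.of_forall hfX) _

theorem eventually_pd_mem_tangentTo {X : Set (Amb n)} (hfX : ∀ z, f z ∈ X)
    (hf : ContDiffWithinAt ℝ 1 f (range (𝓡∂ 2)) y) (hy : y ∈ range (𝓡∂ 2)) (i : Fin 2) :
    ∀ᶠ z in 𝓝[range (𝓡∂ 2)] y, pd i f z ∈ tangentTo X (f z) := by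
  filter_upwards [eventually_contDiffWithinAt (m := 1) hf hy, self_mem_nhdsWithin] with z hz hz'
  exact pd_mem_tangentTo hfX (hz.differentiableWithinAt one_ne_zero) hz' i

end PartialDerivative

section MeanCurvature

open Filter Topology Set

variable {n : ℕ} {c l : ℝ} {M : Set (Amb n)} {ξ : Amb n → Amb n}
  {f : EuclideanSpace ℝ (Fin 2) → Amb n} {y : EuclideanSpace ℝ (Fin 2)}

theorem quad_pd_pd (hfS : ∀ z, f z ∈ spaceForm n c)
    (hf : ContDiffWithinAt ℝ 2 f (range (𝓡∂ 2)) y) (hy : y ∈ range (𝓡∂ 2)) (i j : Fin 2) :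
    quad c (f y) (pd i (pd j f) y) = -(c * met c (pd i f y) (pd j f y)) := by
  have hfd := hf.differentiableWithinAt two_ne_zero
  have hpd := (contDiffWithinAt_pd (m := 1) hf one_add_one_eq_two.le hy j).differentiableWithinAt
    one_ne_zero
  have hzero := pd_eq_zero_of_eventually
    ((eventually_pd_mem_tangentTo hfS (hf.of_le one_le_two) hy j).mono fun z hz =>
      quad_eq_zero_of_mem_tangentTo subset_rfl hz) hy i
  rw [pd_quad hfd hpd hy, quad_eq_mul_met_of_tangent (hfS y)
    (quad_eq_zero_of_mem_tangentTo subset_rfl (pd_mem_tangentTo hfS hfd hy i))] at hzero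
  exact eq_neg_of_add_eq_zero_left hzero

theorem met_pd_pd_normal (hM : IsUmbilicalHypersurface c (spaceForm n c) (projN c) 2 M ξ)
    (hl : ∀ p ∈ M, ∀ v ∈ tangentTo M p, fderiv ℝ ξ p v = -(l • v)) (hfM : ∀ z, f z ∈ M)
    (hf : ContDiffWithinAt ℝ 2 f (range (𝓡∂ 2)) y) (hy : y ∈ range (𝓡∂ 2)) (i j : Fin 2) :
    met c (pd i (pd j f) y) (ξ (f y)) = l * met c (pd i f y) (pd j f y) := by
  have hfd := hf.differentiableWithinAt two_ne_zero
  have hpd := (contDiffWithinAt_pd (m := 1) hf one_add_one_eq_two.le hy j).differentiableWithinAt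
    one_ne_zero
  have hξd := hM.differentiableAt (hfM y)
  have hξfd : DifferentiableWithinAt ℝ (fun z => ξ (f z)) (range (𝓡∂ 2)) y :=
    hξd.comp_differentiableWithinAt y hfd
  have hzero := pd_eq_zero_of_eventually
    ((eventually_pd_mem_tangentTo hfM (hf.of_le one_le_two) hy j).mono fun z hz =>
      hM.normal _ (hfM z) _ hz) hy i
  rw [pd_met hξfd hpd hy, pd_comp hξd hfd hy,
    hl _ (hfM y) _ (pd_mem_tangentTo hfM hfd hy i), ← neg_smul, met_smul_left, met_comm] at hzero
  linarith

theorem met_projN_pd_pd_normal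
    (hM : IsUmbilicalHypersurface c (spaceForm n c) (projN c) 2 M ξ)
    (hl : ∀ p ∈ M, ∀ v ∈ tangentTo M p, fderiv ℝ ξ p v = -(l • v)) (hfM : ∀ z, f z ∈ M)
    (hf : ContDiffWithinAt ℝ 2 f (range (𝓡∂ 2)) y) (hy : y ∈ range (𝓡∂ 2)) (i j : Fin 2) :
    met c (projN c (f y) (pd i (pd j f) y)) (ξ (f y)) = l * met c (pd i f y) (pd j f y) := by
  rw [projN, met_sub_left, met_smul_left, met_pd_pd_normal hM hl hfM hf hy,
    quad_pd_pd (fun z => hM.subset (hfM z)) hf hy]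
  rcases eq_zero_or_met_eq_zero (hM.quad_normal (hfM y)) with h | h
  · rw [h, zero_mul, neg_zero, zero_mul, sub_zero]
  · rw [h, mul_zero, sub_zero]

theorem secondFF_projN_eq (hM : IsUmbilicalHypersurface c (spaceForm n c) (projN c) 2 M ξ)
    (hl : ∀ p ∈ M, ∀ v ∈ tangentTo M p, fderiv ℝ ξ p v = -(l • v)) (hfM : ∀ z, f z ∈ M)
    (hf : ContDiffWithinAt ℝ 2 f (range (𝓡∂ 2)) y) (hy : y ∈ range (𝓡∂ 2)) (i j : Fin 2) :
    secondFF c (projN c) f i j y =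
      secondFF c (projM c ξ) f i j y + (l * met c (pd i f y) (pd j f y)) • ξ (f y) := by
  have hξ : ∀ k, met c (ξ (f y)) (pd k f y) = 0 := fun k =>
    hM.normal _ (hfM y) _ (pd_mem_tangentTo hfM (hf.differentiableWithinAt two_ne_zero) hy k)
  rw [secondFF, secondFF, normalPart, normalPart, projM, met_projN_pd_pd_normal hM hl hfM hf hy,
    sub_eq_add_neg, ← neg_smul, perp_add, perp_smul, perp_of_orthogonal (hξ 0) (hξ 1)]
  module

theorem meanCurv_projN_eq (hM : IsUmbilicalHypersurface c (spaceForm n c) (projN c) 2 M ξ)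
    (hl : ∀ p ∈ M, ∀ v ∈ tangentTo M p, fderiv ℝ ξ p v = -(l • v)) (hfM : ∀ z, f z ∈ M)
    (hf : ContDiffWithinAt ℝ 2 f (range (𝓡∂ 2)) y) (hy : y ∈ range (𝓡∂ 2))
    (hG : gramDet c (pd 0 f y) (pd 1 f y) ≠ 0) :
    meanCurv c (projN c) f y = meanCurv c (projM c ξ) f y + l • ξ (f y) := by
  have htrace : (2 * gramDet c (pd 0 f y) (pd 1 f y))⁻¹ *
      (2 * gramDet c (pd 0 f y) (pd 1 f y)) = 1 := inv_mul_cancel₀ (mul_ne_zero two_ne_zero hG)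
  rw [← one_smul ℝ (l • ξ (f y)), ← htrace, meanCurv, meanCurv]
  simp only [secondFF_projN_eq hM hl hfM hf hy, gramDet]
  module

theorem contDiffWithinAt_secondFF_projN {m : WithTop ℕ∞}
    (hf : ContDiffWithinAt ℝ (m + 2) f (range (𝓡∂ 2)) y) (hy : y ∈ range (𝓡∂ 2))
    (hG : gramDet c (pd 0 f y) (pd 1 f y) ≠ 0) (i j : Fin 2) :
    ContDiffWithinAt ℝ m (secondFF c (projN c) f i j) (range (𝓡∂ 2)) y := by
  have hm : m + 1 + 1 = m + 2 := by rw [add_assoc, one_add_one_eq_two]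
  have hpd : ∀ k, ContDiffWithinAt ℝ (m + 1) (pd k f) (range (𝓡∂ 2)) y :=
    contDiffWithinAt_pd hf hm.le hy
  exact contDiffWithinAt_perp ((hpd 0).of_le le_self_add) ((hpd 1).of_le le_self_add)
    (contDiffWithinAt_projN (hf.of_le le_self_add) (contDiffWithinAt_pd (hpd j) le_rfl hy i)) hG

theorem contDiffWithinAt_meanCurv_projN {m : WithTop ℕ∞}
    (hf : ContDiffWithinAt ℝ (m + 2) f (range (𝓡∂ 2)) y) (hy : y ∈ range (𝓡∂ 2))
    (hG : gramDet c (pd 0 f y) (pd 1 f y) ≠ 0) :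
    ContDiffWithinAt ℝ m (meanCurv c (projN c) f) (range (𝓡∂ 2)) y := by
  have hm : m + 1 ≤ m + 2 := by
    rw [← one_add_one_eq_two, ← add_assoc]
    exact le_self_add
  have hpd : ∀ k, ContDiffWithinAt ℝ m (pd k f) (range (𝓡∂ 2)) y := contDiffWithinAt_pd hf hm hy
  have hmet : ∀ i j, ContDiffWithinAt ℝ m (fun z => met c (pd i f z) (pd j f z))
      (range (𝓡∂ 2)) y := fun i j => contDiffWithinAt_met (hpd i) (hpd j)
  have hA := contDiffWithinAt_secondFF_projN hf hy hG
  exact ((contDiffWithinAt_const.mul (contDiffWithinAt_gramDet (hpd 0) (hpd 1))).inv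
    (mul_ne_zero two_ne_zero hG)).smul ((((hmet 1 1).smul (hA 0 0)).sub
      ((contDiffWithinAt_const.mul (hmet 0 1)).smul (hA 0 1))).add ((hmet 0 0).smul (hA 1 1)))

theorem eventually_gramDet_ne_zero (hf : ContDiffWithinAt ℝ 1 f (range (𝓡∂ 2)) y)
    (hy : y ∈ range (𝓡∂ 2)) (hG : gramDet c (pd 0 f y) (pd 1 f y) ≠ 0) :
    ∀ᶠ z in 𝓝[range (𝓡∂ 2)] y, gramDet c (pd 0 f z) (pd 1 f z) ≠ 0 :=
  have hpd : ∀ i, ContDiffWithinAt ℝ 0 (pd i f) (range (𝓡∂ 2)) y :=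
    contDiffWithinAt_pd hf (zero_add _).le hy
  (contDiffWithinAt_gramDet (hpd 0) (hpd 1)).continuousWithinAt.eventually_ne hG

theorem pd_meanCurv_projM (hM : IsUmbilicalHypersurface c (spaceForm n c) (projN c) 2 M ξ)
    (hl : ∀ p ∈ M, ∀ v ∈ tangentTo M p, fderiv ℝ ξ p v = -(l • v)) (hfM : ∀ z, f z ∈ M)
    (hf : ContDiffWithinAt ℝ 3 f (range (𝓡∂ 2)) y) (hy : y ∈ range (𝓡∂ 2))
    (hG : gramDet c (pd 0 f y) (pd 1 f y) ≠ 0) (i : Fin 2) :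
    pd i (meanCurv c (projM c ξ) f) y = pd i (meanCurv c (projN c) f) y + l ^ 2 • pd i f y := by
  have hf2 : ContDiffWithinAt ℝ 2 f (range (𝓡∂ 2)) y := hf.of_le (by norm_num)
  have hfd := hf2.differentiableWithinAt two_ne_zero
  have hH : meanCurv c (projM c ξ) f =ᶠ[𝓝[range (𝓡∂ 2)] y]
      fun z => meanCurv c (projN c) f z - l • ξ (f z) := by
    filter_upwards [eventually_gramDet_ne_zero (hf2.of_le one_le_two) hy hG,
      eventually_contDiffWithinAt (m := 2) hf2 hy, self_mem_nhdsWithin] with z hGz hfz hz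
    rw [meanCurv_projN_eq hM hl hfM hfz hz hGz, add_sub_cancel_right]
  have hHd := (contDiffWithinAt_meanCurv_projN (m := 1) (hf.of_le (by norm_num)) hy
    hG).differentiableWithinAt one_ne_zero
  have hξd := hM.differentiableAt (hfM y)
  have hξfd : DifferentiableWithinAt ℝ (fun z => ξ (f z)) (range (𝓡∂ 2)) y :=
    hξd.comp_differentiableWithinAt y hfd
  have hξ : pd i (fun z => ξ (f z)) y = -(l • pd i f y) :=
    (pd_comp hξd hfd hy i).trans (hl _ (hfM y) _ (pd_mem_tangentTo hfM hfd hy i))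
  have hsub := (hHd.hasFDerivWithinAt.sub (hξfd.hasFDerivWithinAt.const_smul l)).fderivWithin
    ((𝓡∂ 2).uniqueDiffOn y hy)
  have hpd : pd i (fun z => meanCurv c (projN c) f z - l • ξ (f z)) y =
      pd i (meanCurv c (projN c) f) y - l • pd i (fun z => ξ (f z)) y := DFunLike.congr_fun hsub _
  rw [pd, hH.fderivWithin_eq_of_mem hy, ← pd, hpd, hξ]
  module

theorem normalPart_pd_meanCurv_projM
    (hM : IsUmbilicalHypersurface c (spaceForm n c) (projN c) 2 M ξ)
    (hl : ∀ p ∈ M, ∀ v ∈ tangentTo M p, fderiv ℝ ξ p v = -(l • v)) (hfM : ∀ z, f z ∈ M)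
    (hf : ContDiffWithinAt ℝ 3 f (range (𝓡∂ 2)) y) (hy : y ∈ range (𝓡∂ 2))
    (hG : gramDet c (pd 0 f y) (pd 1 f y) ≠ 0) (i : Fin 2)
    (hpar : normalPart c (projN c) f y (pd i (meanCurv c (projN c) f) y) = 0) :
    normalPart c (projM c ξ) f y (pd i (meanCurv c (projM c ξ) f) y) = 0 := by
  have hT : ∀ k, pd k f y ∈ tangentTo M (f y) :=
    pd_mem_tangentTo hfM (hf.differentiableWithinAt three_ne_zero) hy
  have hξ : ∀ k, met c (ξ (f y)) (pd k f y) = 0 := fun k => hM.normal _ (hfM y) _ (hT k)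
  have hperp : perp c (pd 0 f y) (pd 1 f y) (pd i f y) = 0 := by
    fin_cases i
    exacts [perp_left hG, perp_right hG]
  have hnormal : met c (projN c (f y) (pd i (meanCurv c (projN c) f) y)) (ξ (f y)) = 0 := by
    rw [← met_perp_of_orthogonal (by rw [met_comm, hξ 0]) (by rw [met_comm, hξ 1]), ← normalPart,
      hpar, met_zero_left]
  have htangent : projM c ξ (f y) (l ^ 2 • pd i f y) = l ^ 2 • pd i f y :=
    projM_of_tangent (by rw [quad_smul_right, hM.quad_tangent (hT i), mul_zero])
      (by rw [met_smul_right, hξ, mul_zero])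
  rw [pd_meanCurv_projM hM hl hfM hf hy hG, normalPart, projM_add, htangent, perp_add, perp_smul,
    hperp, smul_zero, add_zero, projM, hnormal, zero_smul, sub_zero, ← normalPart, hpar]

end MeanCurvature

section BranchedSurface

open Filter Set

variable {n : ℕ} {c : ℝ} {S : Type*} [TopologicalSpace S]
  [ChartedSpace (EuclideanHalfSpace 2) S] {u : S → Amb n} {p : S}

theorem localRep_self (u : S → Amb n) (p : S) : localRep u p (extChartAt (𝓡∂ 2) p p) = u p :=
  congrArg u (extChartAt_to_inv p)

theorem extChartAt_mem_range (p : S) : extChartAt (𝓡∂ 2) p p ∈ range (𝓡∂ 2) :=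
  extChartAt_target_subset_range p (mem_extChartAt_target p)

theorem hasFDerivWithinAt_localRep (hu : MDifferentiableAt (𝓡∂ 2) 𝓘(ℝ, Amb n) u p) :
    HasFDerivWithinAt (localRep u p) (du u p) (range (𝓡∂ 2)) (extChartAt (𝓡∂ 2) p p) :=
  hu.hasMFDerivAt.2

theorem pd_localRep (hu : MDifferentiableAt (𝓡∂ 2) 𝓘(ℝ, Amb n) u p) (i : Fin 2) :
    pd i (localRep u p) (extChartAt (𝓡∂ 2) p p) = du u p (EuclideanSpace.single i 1) := by
  rw [pd, (hasFDerivWithinAt_localRep hu).fderivWithin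
    ((𝓡∂ 2).uniqueDiffOn _ (extChartAt_mem_range p))]

theorem du_mem_tangentTo (hu : MDifferentiableAt (𝓡∂ 2) 𝓘(ℝ, Amb n) u p) {X : Set (Amb n)}
    (huX : ∀ q, u q ∈ X) (w : EuclideanSpace ℝ (Fin 2)) : du u p w ∈ tangentTo X (u p) := by
  rw [← localRep_self u p]
  exact mem_tangentTo_of_hasFDerivWithinAt (hasFDerivWithinAt_localRep hu)
    ((𝓡∂ 2).uniqueDiffOn _ (extChartAt_mem_range p)) (extChartAt_mem_range p)
    (Eventually.of_forall fun z => huX _) w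

theorem gramDet_localRep_ne_zero (hu : MDifferentiableAt (𝓡∂ 2) 𝓘(ℝ, Amb n) u p)
    (huS : ∀ q, u q ∈ spaceForm n c) (hp : p ∉ branchSet u) :
    gramDet c (pd 0 (localRep u p) (extChartAt (𝓡∂ 2) p p))
      (pd 1 (localRep u p) (extChartAt (𝓡∂ 2) p p)) ≠ 0 := by
  have hinj : Function.Injective (du u p) := not_not.1 hp
  have hq : ∀ w, quad c (u p) (du u p w) = 0 := fun w =>
    quad_eq_zero_of_mem_tangentTo subset_rfl (du_mem_tangentTo hu huS w)
  rw [pd_localRep hu, pd_localRep hu]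
  refine (gramDet_pos (huS p) (hq _) (hq _) (LinearIndependent.pair_iff.2 fun s t hst => ?_)).ne'
  rw [← map_smul, ← map_smul, ← map_add, map_eq_zero_iff _ hinj] at hst
  exact ⟨by simpa using congrArg (fun z : EuclideanSpace ℝ (Fin 2) => z 0) hst,
    by simpa using congrArg (fun z : EuclideanSpace ℝ (Fin 2) => z 1) hst⟩

theorem three_le_of_notMem_branchSet {X : Set (Amb n)}
    (hu : MDifferentiableAt (𝓡∂ 2) 𝓘(ℝ, Amb n) u p) (hX : IsSubmanifold 2 X)
    (huX : ∀ q, u q ∈ X) (hp : p ∉ branchSet u) : 3 ≤ n := by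
  have hinj : Function.Injective (du u p) := not_not.1 hp
  have hle := LinearMap.finrank_le_finrank_of_injective
    (f := (du u p : EuclideanSpace ℝ (Fin 2) →ₗ[ℝ] Amb n).codRestrict (tangentTo X (u p))
      (du_mem_tangentTo hu huX)) (fun a b hab => hinj (congrArg Subtype.val hab))
  have hrank := hX.finrank_tangentTo_add (huX p)
  rw [finrank_euclideanSpace_fin] at hle
  omega

theorem hasParallelMeanCurv_projM {l : ℝ} {M : Set (Amb n)} {ξ : Amb n → Amb n}
    (hM : IsUmbilicalHypersurface c (spaceForm n c) (projN c) 2 M ξ)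
    (hl : ∀ p ∈ M, ∀ v ∈ tangentTo M p, fderiv ℝ ξ p v = -(l • v))
    (hu : ContMDiff (𝓡∂ 2) 𝓘(ℝ, Amb n) 3 u) (huM : ∀ p, u p ∈ M)
    (hpmc : HasParallelMeanCurv c (projN c) u) : HasParallelMeanCurv c (projM c ξ) u := by
  intro p hp i
  exact normalPart_pd_meanCurv_projM hM hl (fun z => huM _) (contMDiffAt_iff.1 (hu p)).2
    (extChartAt_mem_range p) (gramDet_localRep_ne_zero ((hu p).mdifferentiableAt three_ne_zero)
      (fun q => hM.subset (huM q)) hp) i (hpmc p hp i)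

end BranchedSurface

section Boundary

open Filter Topology Set

variable {n : ℕ} {S : Type*} [TopologicalSpace S] [ChartedSpace (EuclideanHalfSpace 2) S] {p : S}
  {t : EuclideanSpace ℝ (Fin 2)}

theorem extChartAt_apply_zero_of_mem_boundary (hp : p ∈ (𝓡∂ 2).boundary S) :
    extChartAt (𝓡∂ 2) p p 0 = 0 := by
  have h : extChartAt (𝓡∂ 2) p p ∈ frontier (range (𝓡∂ 2)) := hp
  rw [frontier_range_modelWithCornersEuclideanHalfSpace] at h
  exact h.symm

theorem extChartAt_symm_mem_boundary [IsManifold (𝓡∂ 2) 1 S] {z : EuclideanSpace ℝ (Fin 2)}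
    (hz : z ∈ (extChartAt (𝓡∂ 2) p).target) (hz0 : z 0 = 0) :
    (extChartAt (𝓡∂ 2) p).symm z ∈ (𝓡∂ 2).boundary S := by
  have hsrc : (extChartAt (𝓡∂ 2) p).symm z ∈ (chartAt (EuclideanHalfSpace 2) p).source := by
    rw [← extChartAt_source (𝓡∂ 2)]
    exact (extChartAt (𝓡∂ 2) p).map_target hz
  refine ((𝓡∂ 2).isBoundaryPoint_iff_of_mem_atlas one_ne_zero
    (chart_mem_atlas (EuclideanHalfSpace 2) p) hsrc).2 ?_
  change extChartAt (𝓡∂ 2) p ((extChartAt (𝓡∂ 2) p).symm z) ∈ frontier (extChartAt (𝓡∂ 2) p).target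
  rw [(extChartAt (𝓡∂ 2) p).right_inv hz]
  refine ⟨subset_closure hz, fun hint => ?_⟩
  have hpos := interior_mono (extChartAt_target_subset_range p) hint
  rw [interior_range_modelWithCornersEuclideanHalfSpace] at hpos
  exact (show 0 < z 0 from hpos).ne' hz0

theorem extChartAt_add_smul_apply_zero (hp : p ∈ (𝓡∂ 2).boundary S) (ht : t 0 = 0) (s : ℝ) :
    (extChartAt (𝓡∂ 2) p p + s • t) 0 = 0 := by
  rw [PiLp.add_apply, PiLp.smul_apply, ht, extChartAt_apply_zero_of_mem_boundary hp, smul_zero,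
    add_zero]

theorem extChartAt_add_smul_mem_range (hp : p ∈ (𝓡∂ 2).boundary S) (ht : t 0 = 0) (s : ℝ) :
    extChartAt (𝓡∂ 2) p p + s • t ∈ range (𝓡∂ 2) := by
  rw [range_modelWithCornersEuclideanHalfSpace]
  exact (extChartAt_add_smul_apply_zero hp ht s).ge

theorem eventually_extChartAt_add_smul_mem_target (hp : p ∈ (𝓡∂ 2).boundary S) (ht : t 0 = 0) :
    ∀ᶠ s : ℝ in 𝓝 0, extChartAt (𝓡∂ 2) p p + s • t ∈ (extChartAt (𝓡∂ 2) p).target := by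
  have hline : Continuous fun s : ℝ => extChartAt (𝓡∂ 2) p p + s • t := by fun_prop
  have hlim : Tendsto (fun s : ℝ => extChartAt (𝓡∂ 2) p p + s • t) (𝓝 0)
      (𝓝[range (𝓡∂ 2)] (extChartAt (𝓡∂ 2) p p)) :=
    tendsto_nhdsWithin_iff.2 ⟨by simpa only [zero_smul, add_zero] using hline.tendsto 0,
      Eventually.of_forall (extChartAt_add_smul_mem_range hp ht)⟩
  exact hlim.eventually (extChartAt_target_mem_nhdsWithin p)

variable [IsManifold (𝓡∂ 2) 1 S]

theorem du_mem_tangentTo_of_boundary {u : S → Amb n} {K : Set (Amb n)}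
    (hu : MDifferentiableAt (𝓡∂ 2) 𝓘(ℝ, Amb n) u p) (hK : ∀ q ∈ (𝓡∂ 2).boundary S, u q ∈ K)
    (hp : p ∈ (𝓡∂ 2).boundary S) (ht : t 0 = 0) : du u p t ∈ tangentTo K (u p) := by
  have hline : HasFDerivAt (fun s : ℝ => extChartAt (𝓡∂ 2) p p + s • t)
      ((ContinuousLinearMap.id ℝ ℝ).smulRight t) 0 :=
    ((hasFDerivAt_id (0 : ℝ)).smul_const t).const_add _
  have hbase : extChartAt (𝓡∂ 2) p p + (0 : ℝ) • t = extChartAt (𝓡∂ 2) p p := by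
    rw [zero_smul, add_zero]
  have hcurve := (hbase.symm ▸ hasFDerivWithinAt_localRep hu).comp (0 : ℝ)
    hline.hasFDerivWithinAt (s := univ) (fun s _ => extChartAt_add_smul_mem_range hp ht s)
  rw [hasFDerivWithinAt_univ] at hcurve
  have hmem := mem_tangentTo_of_hasFDerivAt (X := K) hcurve
    ((eventually_extChartAt_add_smul_mem_target hp ht).mono fun s hs =>
      hK _ (extChartAt_symm_mem_boundary hs (extChartAt_add_smul_apply_zero hp ht s))) 1
  rw [Function.comp_apply, hbase, localRep_self] at hmem
  simpa using hmem

theorem infinite_boundary (hS : ((𝓡∂ 2).boundary S).Nonempty) : ((𝓡∂ 2).boundary S).Infinite := by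
  obtain ⟨p, hp⟩ := hS
  let t : EuclideanSpace ℝ (Fin 2) := EuclideanSpace.single 1 1
  have ht : t 0 = 0 := by simp [t]
  have hinf := infinite_of_mem_nhds (0 : ℝ) (eventually_extChartAt_add_smul_mem_target hp ht)
  have hinj : InjOn (fun s : ℝ => (extChartAt (𝓡∂ 2) p).symm (extChartAt (𝓡∂ 2) p p + s • t))
      {s : ℝ | extChartAt (𝓡∂ 2) p p + s • t ∈ (extChartAt (𝓡∂ 2) p).target} := by
    intro s hs s' hs' h
    have hst := add_left_cancel ((extChartAt (𝓡∂ 2) p).symm.injOn hs hs' h)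
    simpa [t] using congrArg (fun z : EuclideanSpace ℝ (Fin 2) => z 1) hst
  refine (hinf.image hinj).mono ?_
  rintro _ ⟨s, hs, rfl⟩
  exact extChartAt_symm_mem_boundary hs (extChartAt_add_smul_apply_zero hp ht s)

end Boundary

section ContactAngle

variable {n : ℕ} {c : ℝ}

theorem isGreatest_met_of_isUnitNormal {x m ν : Amb n} {T K : Submodule ℝ (Amb n)}
    (hx : x ∈ spaceForm n c) (hT : ∀ v ∈ T, quad c x v = 0) (hm : IsUnitNormal c T K m)
    (hν : ν ∈ T) (hν1 : met c ν ν = 1) {ι : Type*} {B : Set ι} {A : ι → Amb n}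
    (hmA : ∀ t ∈ B, met c m (A t) = 0) (hνA : ∀ t ∈ B, met c ν (A t) = 0) :
    IsGreatest (insert 0 {s | ∃ y ∈ K, met c y y = 1 ∧ (∀ t ∈ B, met c y (A t) = 0) ∧
      s = met c y ν}) (√(1 - met c m ν ^ 2)) := by
  set w : Amb n := ν - met c m ν • m
  have hwT : w ∈ T := T.sub_mem hν (T.smul_mem _ hm.mem)
  have hww : met c w w = 1 - met c m ν ^ 2 := by rw [met_sub_smul_self hm.unit, hν1]
  have hwm : met c m w = 0 := by rw [met_sub_right, met_smul_right, hm.unit, mul_one, sub_self]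
  have hwν : met c w ν = 1 - met c m ν ^ 2 := by rw [met_sub_left, met_smul_left, hν1, sq]
  refine ⟨?_, ?_⟩
  · rcases le_or_gt (1 - met c m ν ^ 2) 0 with h | h
    · exact .inl (Real.sqrt_eq_zero_of_nonpos h)
    · have hsq := Real.mul_self_sqrt h.le
      have hpos := (Real.sqrt_pos.2 h).ne'
      refine .inr ⟨(√(1 - met c m ν ^ 2))⁻¹ • w, K.smul_mem _ ((hm.mem_iff w).2 ⟨hwT, hwm⟩), ?_,
        fun t ht => ?_, ?_⟩
      · rw [met_smul_left, met_smul_right, hww, inv_mul_eq_div, inv_mul_eq_div, div_div, hsq,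
          div_self h.ne']
      · rw [met_smul_left, met_sub_left, met_smul_left, hmA t ht, hνA t ht, mul_zero, sub_zero,
          mul_zero]
      · rw [met_smul_left, hwν, inv_mul_eq_div, eq_div_iff hpos, hsq]
  · rintro s (rfl | ⟨y, hy, hy1, -, rfl⟩)
    · exact Real.sqrt_nonneg _
    · obtain ⟨hyT, hym⟩ := (hm.mem_iff y).1 hy
      have hle := met_sq_le hx (hT y hyT) (hT _ hwT) hy1
      rw [hww, met_sub_right, met_smul_right, met_comm y m, hym, mul_zero, sub_zero] at hle
      exact (le_abs_self _).trans (Real.abs_le_sqrt hle)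

theorem cos_eq_sqrt_one_sub_sq_iff {φ s : ℝ} (hφ : φ ∈ Set.Icc 0 (Real.pi / 2))
    (hs : s ^ 2 ≤ 1) : Real.cos φ = √(1 - s ^ 2) ↔ Real.sin φ = |s| := by
  have hsin : 0 ≤ Real.sin φ :=
    Real.sin_nonneg_of_nonneg_of_le_pi hφ.1 (hφ.2.trans (half_le_self Real.pi_pos.le))
  rw [Real.cos_eq_sqrt_one_sub_sin_sq (by linarith [hφ.1, Real.pi_pos]) hφ.2,
    Real.sqrt_inj (sub_nonneg.2 (Real.sin_sq_le_one φ)) (sub_nonneg.2 hs), sub_right_inj,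
    sq_eq_sq_iff_abs_eq_abs, abs_of_nonneg hsin]

variable {S : Type*} [TopologicalSpace S] [ChartedSpace (EuclideanHalfSpace 2) S] {u : S → Amb n}
  {p : S}

theorem IsOutConormal.mem_tangentTo {ν : Amb n} (hν : IsOutConormal c u p ν) {X : Set (Amb n)}
    (hu : MDifferentiableAt (𝓡∂ 2) 𝓘(ℝ, Amb n) u p) (huX : ∀ q, u q ∈ X) :
    ν ∈ tangentTo X (u p) := by
  obtain ⟨-, ⟨w, -, rfl⟩, -⟩ := hν
  exact du_mem_tangentTo hu huX w

variable [IsManifold (𝓡∂ 2) 1 S]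

theorem isContactAngle_iff {X K : Set (Amb n)} {m : Amb n} (hX : X ⊆ spaceForm n c)
    (hm : IsUnitNormal c (tangentTo X (u p)) (tangentTo K (u p)) m)
    (hu : MDifferentiableAt (𝓡∂ 2) 𝓘(ℝ, Amb n) u p) (huX : ∀ q, u q ∈ X)
    (huK : ∀ q ∈ (𝓡∂ 2).boundary S, u q ∈ K) (hp : p ∈ (𝓡∂ 2).boundary S) {φ : ℝ} :
    IsContactAngle c K u p φ ↔
      φ ∈ Set.Icc 0 (Real.pi / 2) ∧ ∃ ν, IsOutConormal c u p ν ∧ Real.sin φ = |met c m ν| := by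
  refine and_congr_right fun hφ => exists_congr fun ν => and_congr_right fun hν => ?_
  have hνT := hν.mem_tangentTo hu huX
  have hT : ∀ v ∈ tangentTo X (u p), quad c (u p) v = 0 := fun v hv =>
    quad_eq_zero_of_mem_tangentTo hX hv
  have hle : met c m ν ^ 2 ≤ 1 :=
    (met_sq_le (hX (huX p)) (hT m hm.mem) (hT ν hνT) hm.unit).trans_eq hν.1
  have hgreatest := isGreatest_met_of_isUnitNormal (hX (huX p)) hT hm hνT hν.1
    (B := {t : EuclideanSpace ℝ (Fin 2) | t 0 = 0}) (A := du u p)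
    (fun t ht => ((hm.mem_iff _).1 (du_mem_tangentTo_of_boundary hu huK hp ht)).2)
    (fun t ht => (met_comm _ _).trans (hν.2.2 t ht))
  rw [← cos_eq_sqrt_one_sub_sq_iff hφ hle]
  exact ⟨fun h => h.unique hgreatest, fun h => h ▸ hgreatest⟩

variable {M N : Set (Amb n)} {ξ η : Amb n → Amb n} {κ θ : ℝ}

theorem IsContactAngle.sin_sq_le (h : IsContactAngle c N u p θ)
    (hM : IsUmbilicalHypersurface c (spaceForm n c) (projN c) 2 M ξ)
    (hN : IsUmbilicalHypersurface c (spaceForm n c) (projN c) 2 N η)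
    (hu : MDifferentiableAt (𝓡∂ 2) 𝓘(ℝ, Amb n) u p) (huM : ∀ q, u q ∈ M)
    (huN : ∀ q ∈ (𝓡∂ 2).boundary S, u q ∈ N) (hp : p ∈ (𝓡∂ 2).boundary S)
    (hκ : met c (η (u p)) (ξ (u p)) = κ) : Real.sin θ ^ 2 ≤ 1 - κ ^ 2 := by
  obtain ⟨-, ν, hν, hsin⟩ := (isContactAngle_iff subset_rfl
    (hN.isUnitNormal (isSubmanifold_spaceForm n c) (huN p hp)) hu
    (fun q => hM.subset (huM q)) huN hp).1 h
  have hνM := hν.mem_tangentTo hu huM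
  have hmem := hM.sub_smul_normal_mem hN (huM p) (huN p hp) hκ
  have hle := met_sq_le (hM.subset (huM p)) (hM.quad_tangent hνM) (hM.quad_tangent hmem) hν.1
  rw [met_comm ν, met_sub_left, met_smul_left, hM.normal _ (huM p) ν hνM, mul_zero, sub_zero,
    ← hκ, met_comm (η (u p)) (ξ (u p)), met_sub_smul_self (hM.unit _ (huM p)),
    hN.unit _ (huN p hp), met_comm (ξ (u p)), hκ] at hle
  rwa [hsin, sq_abs]

theorem IsContactAngle.inter {φ : ℝ} (h : IsContactAngle c N u p θ)
    (hM : IsUmbilicalHypersurface c (spaceForm n c) (projN c) 2 M ξ)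
    (hN : IsUmbilicalHypersurface c (spaceForm n c) (projN c) 2 N η)
    (hC : IsUmbilicalHypersurface c M (projM c ξ) 3 (M ∩ N) (interNormal ξ η κ))
    (hu : MDifferentiableAt (𝓡∂ 2) 𝓘(ℝ, Amb n) u p) (huM : ∀ q, u q ∈ M)
    (huN : ∀ q ∈ (𝓡∂ 2).boundary S, u q ∈ N) (hp : p ∈ (𝓡∂ 2).boundary S)
    (hφ : φ ∈ Set.Icc 0 (Real.pi / 2)) (hsin : Real.sin φ = Real.sin θ / √(1 - κ ^ 2)) :
    IsContactAngle c (M ∩ N) u p φ := by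
  obtain ⟨-, ν, hν, hθ⟩ := (isContactAngle_iff subset_rfl
    (hN.isUnitNormal (isSubmanifold_spaceForm n c) (huN p hp)) hu
    (fun q => hM.subset (huM q)) huN hp).1 h
  have huC : ∀ q ∈ (𝓡∂ 2).boundary S, u q ∈ M ∩ N := fun q hq => ⟨huM q, huN q hq⟩
  refine (isContactAngle_iff hM.subset (hC.isUnitNormal hM.submanifold (huC p hp)) hu huM huC
    hp).2 ⟨hφ, ν, hν, ?_⟩
  rw [met_interNormal (hM.normal _ (huM p) ν (hν.mem_tangentTo hu huM)), hsin, hθ, abs_div,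
    abs_of_nonneg (Real.sqrt_nonneg _)]

end ContactAngle

section Trig

theorem sin_arcsin_div_sqrt {s κ : ℝ} (hs : 0 ≤ s) (hsκ : s ^ 2 ≤ 1 - κ ^ 2) :
    Real.sin (Real.arcsin (s / √(1 - κ ^ 2))) = s / √(1 - κ ^ 2) :=
  Real.sin_arcsin (by linarith [div_nonneg hs (Real.sqrt_nonneg (1 - κ ^ 2))])
    (div_le_one_of_le₀ (Real.le_sqrt_of_sq_le hsκ) (Real.sqrt_nonneg _))

end Trig

end SpaceFormPMC

theorem mainTheorem3_general {n : ℕ} (c : ℝ) {S : Type*} [TopologicalSpace S]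
    [ChartedSpace (EuclideanHalfSpace 2) S] [IsManifold (𝓡∂ 2) 3 S]
    (o : Amb n) (ho : o ∈ spaceForm n c)
    (r : ℝ) (hr : 0 < r) (hrc : 0 < c → r < Real.pi / √c)
    (u : S → Amb n) (hu : ContMDiff (𝓡∂ 2) 𝓘(ℝ, Amb n) 3 u)
    (hB : ∃ p ∈ (𝓡∂ 2).boundary S, p ∉ branchSet u)
    (hfree : ∀ p ∈ (𝓡∂ 2).boundary S, u p ∈ geodSphere c o r)
    (hpmc : HasParallelMeanCurv c (projN c) u)
    (θ : ℝ) (hθ : 0 < θ)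
    (hangle : ∀ p ∈ (𝓡∂ 2).boundary S, p ∉ branchSet u → IsContactAngle c (geodSphere c o r) u p θ)
    (M : Set (Amb n)) (ξ : Amb n → Amb n) (hMc : IsPreconnected M)
    (hM : IsUmbilicalHypersurface c (spaceForm n c) (projN c) 2 M ξ)
    (huM : ∀ p, u p ∈ M) :
    HasParallelMeanCurv c (projM c ξ) u ∧
    (∃ η, IsUmbilicalHypersurface c M (projM c ξ) 3 (M ∩ geodSphere c o r) η) ∧
    ∃ α ∈ Set.Ioo 0 Real.pi, ∃ θM ∈ Set.Ioc 0 (Real.pi / 2),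
      (∀ p ∈ (𝓡∂ 2).boundary S,
        |met c (outNormal c o r (u p)) (ξ (u p))| < 1 ∧
        met c (outNormal c o r (u p)) (ξ (u p)) = Real.cos α ∧
        Real.sin θM =
          Real.sin θ / √(1 - met c (outNormal c o r (u p)) (ξ (u p)) ^ 2)) ∧
      Real.sin θM = Real.sin θ / Real.sin α ∧
      ∀ p ∈ (𝓡∂ 2).boundary S, p ∉ branchSet u →
        IsContactAngle c (M ∩ geodSphere c o r) u p θM := by
  have hs : 0 < sn c r := sn_pos hr hrc
  have hN := isUmbilicalHypersurface_geodSphere hs ho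
  have hdu : ∀ p, MDifferentiableAt (𝓡∂ 2) 𝓘(ℝ, Amb n) u p := hu.mdifferentiable (by norm_num)
  obtain ⟨p₀, hp₀, hp₀B⟩ := hB
  have hn := three_le_of_notMem_branchSet (hdu p₀) hM.submanifold huM hp₀B
  obtain ⟨l, hl⟩ := hM.exists_const_curvature hMc hn
  obtain ⟨κ, hκ⟩ := hM.exists_met_outNormal_eq hMc hl hs ho
  have hκu p (hp : p ∈ (𝓡∂ 2).boundary S) := hκ _ ⟨huM p, hfree p hp⟩
  have hθκ := (hangle p₀ hp₀ hp₀B).sin_sq_le hM hN (hdu p₀) huM hfree hp₀ (hκu p₀ hp₀)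
  have hθ0 : 0 < Real.sin θ := Real.sin_pos_of_pos_of_lt_pi hθ
    (by linarith [(hangle p₀ hp₀ hp₀B).1.2, Real.pi_pos])
  have hκ1 : κ ^ 2 < 1 := by nlinarith
  have hκabs : |κ| < 1 := (sq_lt_one_iff_abs_lt_one κ).1 hκ1
  have hC := hM.inter hN (hM.isSubmanifold_inter_geodSphere hs ho hκ1 hκ) hκ1 hκ
  have hsinM := sin_arcsin_div_sqrt hθ0.le hθκ
  have hθM : 0 < Real.arcsin (Real.sin θ / √(1 - κ ^ 2)) :=
    Real.arcsin_pos.2 (div_pos hθ0 (Real.sqrt_pos.2 (sub_pos.2 hκ1)))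
  refine ⟨hasParallelMeanCurv_projM hM hl hu huM hpmc, ⟨_, hC⟩, Real.arccos κ,
    ⟨Real.arccos_pos.2 (abs_lt.1 hκabs).2, Real.arccos_lt_pi.2 (abs_lt.1 hκabs).1⟩, _,
    ⟨hθM, Real.arcsin_le_pi_div_two _⟩, fun p hp => ?_, by rw [Real.sin_arccos, hsinM],
    fun p hp hpB => (hangle p hp hpB).inter hM hN hC (hdu p) huM hfree hp
      ⟨hθM.le, Real.arcsin_le_pi_div_two _⟩ hsinM⟩
  rw [hκu p hp, Real.cos_arccos (abs_lt.1 hκabs).1.le (abs_lt.1 hκabs).2.le]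
  exact ⟨hκabs, rfl, hsinM⟩

theorem mainTheorem3 {n : ℕ} (c : ℝ) {S : Type*} [TopologicalSpace S]
    [ChartedSpace (EuclideanHalfSpace 2) S] [IsManifold (𝓡∂ 2) ∞ S]
    (g : Bundle.ContMDiffRiemannianMetric (𝓡∂ 2) ∞ (EuclideanSpace ℝ (Fin 2))
      (fun p : S => TangentSpace (𝓡∂ 2) p))
    (hS : ((𝓡∂ 2).boundary S).Nonempty)
    (o : Amb n) (ho : o ∈ spaceForm n c)
    (r : ℝ) (hr : 0 < r) (hrc : 0 < c → r < Real.pi / √c)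
    (u : S → Amb n) (hu : IsBranchedImmersion c g u)
    (hball : ∀ p, u p ∈ geodBall c o r)
    (hfree : ∀ p ∈ (𝓡∂ 2).boundary S, u p ∈ geodSphere c o r)
    (hpmc : HasParallelMeanCurv c (projN c) u)
    (hne : ∃ p ∉ branchSet u, meanCurvAt c (projN c) u p ≠ 0)
    (θ : ℝ) (hθ : 0 < θ)
    (hangle : ∀ p ∈ (𝓡∂ 2).boundary S, p ∉ branchSet u → IsContactAngle c (geodSphere c o r) u p θ)
    (M : Set (Amb n)) (ξ : Amb n → Amb n) (hMc : IsConnected M)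
    (hM : IsUmbilicalHypersurface c (spaceForm n c) (projN c) 2 M ξ)
    (huM : ∀ p, u p ∈ M) :
    HasParallelMeanCurv c (projM c ξ) u ∧
    (∃ η, IsUmbilicalHypersurface c M (projM c ξ) 3 (M ∩ geodSphere c o r) η) ∧
    ∃ α ∈ Set.Ioo 0 Real.pi, ∃ θM ∈ Set.Ioc 0 (Real.pi / 2),
      (∀ p ∈ (𝓡∂ 2).boundary S,
        |met c (outNormal c o r (u p)) (ξ (u p))| < 1 ∧
        met c (outNormal c o r (u p)) (ξ (u p)) = Real.cos α ∧
        Real.sin θM =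
          Real.sin θ / √(1 - met c (outNormal c o r (u p)) (ξ (u p)) ^ 2)) ∧
      Real.sin θM = Real.sin θ / Real.sin α ∧
      ∀ p ∈ (𝓡∂ 2).boundary S, p ∉ branchSet u →
        IsContactAngle c (M ∩ geodSphere c o r) u p θM := by
  exact mainTheorem3_general c o ho r hr hrc u (hu.smooth.of_le ENat.LEInfty.out)
    ((infinite_boundary hS).sdiff hu.finite).nonempty hfree hpmc θ hθ hangle M ξ
    hMc.isPreconnected hM huM
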